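/- All vector spaces are real and all spaces are Hausdorff. A locally convex space $E$ is a \emph{strict $(LF)$-space} if it is the union of an increasing sequence of vector subspaces $E_n$ ($n\in\omega$), each with a Fréchet space topology $\tau_n$ such that $\tau_{n+1}|_{E_n}=\tau_n$, and $E$ carries the locally convex inductive limit topology (the finest locally convex topology making all inclusions $E_n\to E$ continuous). $E$ is \emph{Montel} if it is barrelled and every bounded subset of $E$ is relatively compact. $E'_\beta$ denotes the dual of $E$ with the topology of uniform convergence on bounded subsets of $E$. Let $\varphi=\varinjlim\mathbb R^n$ be the space of finitely supported real sequences with its inductive limit topology. A Tychonoff space $X$ is \emph{Ascoli} if every compact subset of $C_k(X)$ (the continuous real-valued functions on $X$ with the compact-open topology) is equicontinuous. A space is an \emph{$\mathcal{MK}_\omega$-space} if it is the inductive limit of an increasing sequence of metrizable compact subsets $C_n$ covering it (a set is open iff its trace on each $C_n$ is open in $C_n$). \textbf{Theorem.} Let $E$ be a Montel strict $(LF)$-space. Then $E'_\beta$ is an Ascoli space if and only if (i) $E$ is a Fréchet space (hence a Fréchet--Montel space), or (ii) $E$ is isomorphic to $\varphi$ as a topological vector space. Moreover, in case (i) $E'_\beta$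 is a sequential $\mathcal{MK}_\omega$-space, and it is not Fréchet--Urysohn if in addition $E$ is infinite-dimensional; in case (ii) $E'_\beta$ is isomorphic to $\mathbb R^\omega$ (with the product topology) as a topological vector space. Consequently, for every $d\ge 1$ and every non-empty open set $\Omega\subseteq\mathbb R^d$, the space of distributions $\mathcal D'(\Omega)$, i.e. the strong dual of the space $\mathcal D(\Omega)$ of real-valued test functions, is not an Ascoli space. -/

import Mathlib

/-- A (real) Fréchet space: a complete metrizable locally convex topological vector space.
Completeness refers to the canonical uniform structure of the additive topological group. -/
structure IsFrechetSpace (E : Type*) [AddCommGroup E] [Module ℝ E] [TopologicalSpace E] :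
    Prop where
  isTopologicalAddGroup : IsTopologicalAddGroup E
  continuousSMul : ContinuousSMul ℝ E
  locallyConvexSpace : LocallyConvexSpace ℝ E
  metrizableSpace : TopologicalSpace.MetrizableSpace E
  completeSpace : @CompleteSpace E (IsTopologicalAddGroup.rightUniformSpace E)

/-- The locally convex inductive limit topology on `E` with respect to a family of maps
`f i : X i → E`: the finest locally convex vector space topology on `E` for which every `f i` is
continuous (in Mathlib's order on topologies, finer means smaller). -/
@[reducible] def locallyConvexLimitTopology {ι : Type*} {E : Type*} [AddCommGroup E] [Module ℝ E]
    {X : ι → Type*} (τ : ∀ i, TopologicalSpace (X i)) (f : ∀ i, X i → E) : TopologicalSpace E :=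
  sInf {t : TopologicalSpace E |
    (∀ i, @Continuous (X i) E (τ i) t (f i)) ∧
    @IsTopologicalAddGroup E t _ ∧
    @ContinuousSMul ℝ E _ _ t ∧
    @LocallyConvexSpace ℝ E _ _ _ _ t}

/-- `E` is a strict (LF)-space: `E` is the union of an increasing sequence of vector subspaces
`F n`, each carrying a Fréchet space topology `τ n`, such that `τ (n + 1)` induces `τ n` on `F n`,
and `E` carries the locally convex inductive limit topology of the spaces `(F n, τ n)`. -/
def IsStrictLFSpace (E : Type*) [AddCommGroup E] [Module ℝ E] [tE : TopologicalSpace E] : Prop :=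
  ∃ (F : ℕ → Submodule ℝ E) (τ : ∀ n, TopologicalSpace (F n)) (hF : Monotone F),
    (∀ x : E, ∃ n, x ∈ F n) ∧
    (∀ n, @IsFrechetSpace (F n) _ _ (τ n)) ∧
    (∀ n, τ n = (τ (n + 1)).induced (Submodule.inclusion (hF n.le_succ))) ∧
    tE = locallyConvexLimitTopology τ (fun n (x : F n) => (x : E))

/-- The underlying vector space of `φ`: finitely supported real sequences. -/
def Phi : Type := ℕ →₀ ℝ

noncomputable instance Phi.instAddCommGroup : AddCommGroup Phi :=
  inferInstanceAs (AddCommGroup (ℕ →₀ ℝ))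

noncomputable instance Phi.instModule : Module ℝ Phi :=
  inferInstanceAs (Module ℝ (ℕ →₀ ℝ))

/-- The embedding `ℝⁿ → φ`, `(x₀, …, xₙ₋₁) ↦ (x₀, …, xₙ₋₁, 0, 0, …)`. -/
noncomputable def Phi.ofFin (n : ℕ) (x : Fin n → ℝ) : Phi :=
  ∑ i : Fin n, (Finsupp.single (i : ℕ) (x i) : ℕ →₀ ℝ)

/-- `φ` is the inductive limit of the sequence of the spaces `ℝⁿ`. -/
noncomputable instance Phi.instTopologicalSpace : TopologicalSpace Phi :=
  locallyConvexLimitTopology (X := fun n : ℕ => Fin n → ℝ) (fun _ => inferInstance) Phi.ofFin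

/-- A Tychonoff space `X` is Ascoli if every compact subset of `C(X, ℝ)`, with the compact-open
topology, is equicontinuous. -/
structure IsAscoliSpace (X : Type*) [TopologicalSpace X] : Prop where
  t35Space : T35Space X
  equicontinuous : ∀ K : Set C(X, ℝ), IsCompact K →
    Equicontinuous (fun (f : K) (x : X) => (f : C(X, ℝ)) x)

/-- A Hausdorff space `X` is an `MK_ω`-space if it is the (topological) inductive limit of an
increasing sequence of metrizable compact subsets. -/
structure IsMKOmegaSpace (X : Type*) [TopologicalSpace X] : Prop where
  t2Space : T2Space X
  exists_seq : ∃ C : ℕ → Set X, Monotone C ∧ (⋃ n, C n) = Set.univ ∧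
    (∀ n, IsCompact (C n)) ∧ (∀ n, TopologicalSpace.MetrizableSpace (C n)) ∧
    ∀ U : Set X, IsOpen U ↔ ∀ n, IsOpen ((fun x : C n => (x : X)) ⁻¹' U)

/-!
# Strong duals of Montel strict (LF)-spaces that are Ascoli

Everything rests on a criterion for the strong dual of a locally convex space `E` *not* to be
Ascoli (`not_isAscoliSpace_strongDual_of_functionals`). Suppose `E` carries functionals `ζ n` such
that every weighted supremum of the `|ζ n|` is dominated by a continuous seminorm, so that on a
bounded set all but finitely many `ζ n` vanish; and suppose that the kernel of `ζ n` contains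
vectors `w n k` on which a continuous seminorm `q n` is unbounded as `k` grows, although every
selection `n ↦ w n (κ n)` is bounded. Then, for any `x n` with `ζ n (x n) ≠ 0`, the functions
`χ ↦ (χ (x n) - k)⁺ (χ (w n k) - (n + 1))⁺` tend to `0` in the compact-open topology: on a compact
set of functionals only finitely many of them do not vanish identically. They are not
equicontinuous at the origin: given a bounded set `B`, choose `n` such that `ζ n` vanishes on `B`;
a functional dominated by a multiple of `q n` lies in the polar of `B` and can be made large on
some `w n k`, and adding a multiple of `ζ n` makes it large on `x n` as well.

For a strict (LF)-space, the step topologies are induced from `E` and the steps are closed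
(`IsStrictLFSpace.exists_submodules`, a consequence of the extension of seminorms). If no step is
all of `E` and some step is infinite-dimensional, the criterion applies
(`not_isAscoliSpace_of_submodules`): the `ζ n` vanish on larger and larger steps, and the `w n k`
lie in a decreasing base of neighbourhoods of the origin of an infinite-dimensional metrizable step,
which are unbounded by the Montel property. Otherwise `E` is one of its steps, hence Fréchet, or all
steps are finite-dimensional, and then every seminorm on `E` is continuous and `E` is isomorphic
to `φ` (`nonempty_continuousLinearEquiv_phi`).

Conversely, the strong dual of `φ` is `ℝ^ω`, which is metrizable. If `E` is Fréchet and Montel, then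
`E` is separable, polars of neighbourhoods are compact and metrizable in the strong dual, and by a
Banach–Dieudonné argument (`mem_nhds_zero_of_forall_isClosed_dualBall_diff`) the strong dual is
their inductive limit. Sequential spaces are Ascoli, as a sequence together with its limit is
compact. Convergent sequences in the dual are equicontinuous, while polars of neighbourhoods have
empty interior when `E` is infinite-dimensional, which contradicts the Fréchet–Urysohn property.

For test functions the criterion applies directly: the `ζ n` are evaluations at points escaping
from every compact subset, and the `w n k` are rescaled bump functions near a fixed point.
-/

open Filter Topology Set Bornology

/-! ### A criterion for a strong dual not to be Ascoli -/

/-- Compact sets of functionals are uniformly bounded on bounded sets. -/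
theorem StrongDual.exists_bound_of_isCompact {E : Type*} [AddCommGroup E] [Module ℝ E]
    [TopologicalSpace E] [ContinuousSMul ℝ E] {K : Set (StrongDual ℝ E)} (hK : IsCompact K)
    {B : Set E} (hB : IsVonNBounded ℝ B) : ∃ M : ℝ, ∀ χ ∈ K, ∀ b ∈ B, |χ b| ≤ M := by
  let := IsTopologicalAddGroup.rightUniformSpace (StrongDual ℝ E)
  have : IsUniformAddGroup (StrongDual ℝ E) := isUniformAddGroup_of_addCommGroup
  have hKb : IsVonNBounded ℝ K := hK.isVonNBounded ℝ
  have h := ContinuousLinearMap.isVonNBounded_image2_apply hKb hB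
  obtain ⟨M, hM⟩ := (NormedSpace.isVonNBounded_iff' ℝ).1 h
  exact ⟨M, fun χ hχ b hb => hM _ ⟨χ, hχ, b, hb, rfl⟩⟩

/-- Neighbourhoods of `0` in the strong dual contain polars of bounded sets. -/
theorem StrongDual.exists_polar_subset {E : Type*} [AddCommGroup E] [Module ℝ E]
    [TopologicalSpace E] [ContinuousSMul ℝ E] {U : Set (StrongDual ℝ E)} (hU : U ∈ 𝓝 0) :
    ∃ B : Set E, IsVonNBounded ℝ B ∧ ∀ χ : StrongDual ℝ E, (∀ b ∈ B, |χ b| ≤ 1) → χ ∈ U := by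
  obtain ⟨⟨B, ε⟩, ⟨hB, hε⟩, h⟩ := (ContinuousLinearMap.hasBasis_nhds_zero_of_basis
    (Metric.nhds_basis_closedBall (x := (0 : ℝ)))).mem_iff.1 hU
  have hB' : IsVonNBounded ℝ ((fun b => ε⁻¹ • b) '' B) :=
    hB.image (ε⁻¹ • ContinuousLinearMap.id ℝ E)
  refine ⟨_, hB', fun χ hχ => h fun b hb => ?_⟩
  have h1 := hχ (ε⁻¹ • b) ⟨b, hb, rfl⟩
  simp only [map_smul, smul_eq_mul, abs_mul, abs_inv, abs_of_pos (show 0 < ε from hε)] at h1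
  rw [inv_mul_le_iff₀ hε, mul_one] at h1
  simpa using h1

/-- A strong dual is not Ascoli as soon as there are vectors `x n` and `w n k` such that all
selections `n ↦ w n (κ n)` are bounded, while every polar of a bounded set contains a functional
that is larger than `k` on some `x n` and larger than `n + 1` on the corresponding `w n k`.
The products `(χ (x n) - k)⁺ (χ (w n k) - (n + 1))⁺` then converge to `0` uniformly on compact
sets but are not equicontinuous at the origin. -/
theorem not_isAscoliSpace_strongDual {E : Type*} [AddCommGroup E] [Module ℝ E]
    [TopologicalSpace E] [ContinuousSMul ℝ E] (x : ℕ → E) (w : ℕ → ℕ → E)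
    (hw : ∀ κ : ℕ → ℕ, IsVonNBounded ℝ (range fun n => w n (κ n)))
    (h : ∀ B : Set E, IsVonNBounded ℝ B → ∃ (n k : ℕ) (χ : StrongDual ℝ E),
      (∀ b ∈ B, |χ b| ≤ 1) ∧ (k + 1 : ℝ) ≤ χ (x n) ∧ (n + 2 : ℝ) ≤ χ (w n k)) :
    ¬ IsAscoliSpace (StrongDual ℝ E) := by
  intro hA
  let f : ℕ × ℕ → C(StrongDual ℝ E, ℝ) := fun nk =>
    ⟨fun χ => max (χ (x nk.1) - nk.2) 0 * max (χ (w nk.1 nk.2) - (nk.1 + 1)) 0, by fun_prop⟩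
  have hf : ∀ n k χ, f (n, k) χ = max (χ (x n) - k) 0 * max (χ (w n k) - (n + 1)) 0 :=
    fun _ _ _ => rfl
  -- On a compact set, all but finitely many of the functions vanish.
  have hlim : Tendsto f cofinite (𝓝 0) := by
    rw [ContinuousMap.tendsto_iff_forall_isCompact_tendstoUniformlyOn]
    intro K hK
    have hfin : ∀ᶠ nk in cofinite, ∀ χ ∈ K, f nk χ = 0 := by
      classical
      let P : ℕ → ℕ → Prop := fun n k => ∃ χ ∈ K, f (n, k) χ ≠ 0
      let κ : ℕ → ℕ := fun n => if hn : ∃ k, P n k then hn.choose else 0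
      obtain ⟨M, hM⟩ := StrongDual.exists_bound_of_isCompact hK (hw κ)
      have hx : ∀ n, ∃ C : ℝ, ∀ χ ∈ K, |χ (x n)| ≤ C := fun n => by
        obtain ⟨C, hC⟩ := StrongDual.exists_bound_of_isCompact hK
          (isVonNBounded_singleton (𝕜 := ℝ) (x n))
        exact ⟨C, fun χ hχ => hC χ hχ _ rfl⟩
      choose C hC using hx
      have hsub : {nk : ℕ × ℕ | P nk.1 nk.2} ⊆
          ⋃ n ∈ Finset.range ⌈M⌉₊, {n} ×ˢ (Finset.range ⌈C n⌉₊ : Set ℕ) := by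
        rintro ⟨n, k⟩ hP
        have hn : ∃ k, P n k := ⟨k, hP⟩
        have hκ : P n (κ n) := by simp only [κ, dif_pos hn]; exact hn.choose_spec
        have h1 : (n : ℝ) < M := by
          obtain ⟨χ, hχ, hne⟩ := hκ
          rw [hf] at hne
          by_contra hcon
          have := (le_abs_self _).trans (hM χ hχ _ (mem_range_self n))
          exact hne (by rw [max_eq_right (a := χ (w n (κ n)) - _) (by linarith), mul_zero])
        have h2 : (k : ℝ) < C n := by
          obtain ⟨χ, hχ, hne⟩ := hP
          rw [hf] at hne
          by_contra hcon
          have := (le_abs_self _).trans (hC n χ hχ)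
          exact hne (by rw [max_eq_right (a := χ (x n) - _) (by linarith), zero_mul])
        simp only [mem_iUnion, Finset.mem_range]
        exact ⟨n, Nat.lt_ceil.2 h1, by simpa using Nat.lt_ceil.2 h2⟩
      refine (((Finset.range ⌈M⌉₊).finite_toSet.biUnion
        fun n _ => ((finite_singleton n).prod (Finset.finite_toSet _))).subset hsub).subset ?_
      intro nk hnk
      simpa [P] using hnk
    rw [Metric.tendstoUniformlyOn_iff]
    intro ε hε
    filter_upwards [hfin] with nk hnk χ hχ
    simpa [hnk χ hχ] using hε
  have hcomp := hlim.isCompact_insert_range_of_cofinite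
  have heq := hA.equicontinuous _ hcomp 0
  rw [Metric.equicontinuousAt_iff_right] at heq
  obtain ⟨B, hB, hBU⟩ := StrongDual.exists_polar_subset (heq 1 one_pos)
  obtain ⟨n, k, χ, hχB, h1, h2⟩ := h B hB
  have h3 := hBU χ hχB ⟨f (n, k), Or.inr ⟨_, rfl⟩⟩
  have h0 : f (n, k) 0 = 0 := by
    rw [hf]
    simp only [zero_apply, zero_sub]
    rw [max_eq_right (by simp), zero_mul]
  have h4 : (1 : ℝ) ≤ f (n, k) χ := by
    rw [hf, ← one_mul (1 : ℝ)]
    exact mul_le_mul (le_max_of_le_left (by linarith)) (le_max_of_le_left (by linarith)) zero_le_one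
      (le_max_right _ _)
  simp only [h0, Real.dist_eq, zero_sub, abs_neg] at h3
  exact absurd h3 (not_lt.2 (h4.trans (le_abs_self _)))

/-- If the functionals `ζ n` are so sparse that every weighted family `c n * |ζ n ·|` is dominated
by one continuous seminorm, then every bounded set is annihilated by some `ζ n`. -/
theorem exists_forall_apply_eq_zero {E : Type*} [AddCommGroup E] [Module ℝ E]
    [TopologicalSpace E] [IsTopologicalAddGroup E] [ContinuousSMul ℝ E] [LocallyConvexSpace ℝ E]
    (ζ : ℕ → StrongDual ℝ E)
    (hζ : ∀ c : ℕ → ℝ, ∃ p : Seminorm ℝ E, Continuous p ∧ ∀ n x, c n * |ζ n x| ≤ p x)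
    {B : Set E} (hB : IsVonNBounded ℝ B) : ∃ n, ∀ b ∈ B, ζ n b = 0 := by
  by_contra! hcon
  choose b hbB hb using hcon
  obtain ⟨p, hp, hpc⟩ := hζ fun n => n / |ζ n (b n)|
  obtain ⟨r, -, hr⟩ := (PolynormableSpace.withSeminorms ℝ E).isVonNBounded_iff_seminorm_bounded.1 hB
    ⟨p, hp⟩
  obtain ⟨n, hn⟩ := exists_nat_gt r
  have h1 := hpc n (b n)
  rw [div_mul_cancel₀ _ (abs_ne_zero.2 (hb n))] at h1
  exact absurd ((h1.trans_lt (hr _ (hbB n))).trans hn) (lt_irrefl _)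

/-- The form of `not_isAscoliSpace_strongDual` used below: the functionals `ζ n` detect `x n`,
ignore all `w n k`, and leave every bounded set after some stage; the seminorm `q n` is unbounded
along `k ↦ w n k`. -/
theorem not_isAscoliSpace_strongDual_of_functionals {E : Type*} [AddCommGroup E] [Module ℝ E]
    [TopologicalSpace E] [IsTopologicalAddGroup E] [ContinuousSMul ℝ E] [LocallyConvexSpace ℝ E]
    (x : ℕ → E) (w : ℕ → ℕ → E) (ζ : ℕ → StrongDual ℝ E) (q : ℕ → Seminorm ℝ E)
    (hw : ∀ κ : ℕ → ℕ, IsVonNBounded ℝ (range fun n => w n (κ n)))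
    (hq : ∀ n, Continuous (q n)) (hqw : ∀ n k : ℕ, (k : ℝ) ≤ q n (w n k))
    (hζx : ∀ n, ζ n (x n) ≠ 0) (hζw : ∀ n k, ζ n (w n k) = 0)
    (hζ : ∀ c : ℕ → ℝ, ∃ p : Seminorm ℝ E, Continuous p ∧ ∀ n x, c n * |ζ n x| ≤ p x) :
    ¬ IsAscoliSpace (StrongDual ℝ E) := by
  refine not_isAscoliSpace_strongDual x w hw fun B hB => ?_
  obtain ⟨n, hn⟩ := exists_forall_apply_eq_zero ζ hζ hB
  obtain ⟨r, hr, hrB⟩ :=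
    (PolynormableSpace.withSeminorms ℝ E).isVonNBounded_iff_seminorm_bounded.1 hB ⟨q n, hq n⟩
  obtain ⟨k, hk⟩ := exists_nat_ge ((n + 2) * r)
  -- A functional dominated by `q n` that attains `q n` at `w n k`.
  obtain ⟨g, hgw, hg⟩ : ∃ g : StrongDual ℝ E, g (w n k) = q n (w n k) ∧ ∀ y, |g y| ≤ q n y := by
    have hkpos : 0 < q n (w n k) := lt_of_lt_of_le (by positivity) (hk.trans (hqw n k))
    have hne : w n k ≠ 0 := fun h0 => by simp [h0] at hkpos
    let e := LinearEquiv.toSpanNonzeroSingleton ℝ E (w n k) hne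
    obtain ⟨g, hg1, hg2⟩ := Module.Dual.exists_continuous_extension_of_le_seminorm_real
      (ℝ ∙ (w n k)) (q n (w n k) • (e.symm : _ →ₗ[ℝ] ℝ)) (hq n) (by
        intro y
        obtain ⟨t, rfl⟩ := e.surjective y
        have : ((e t : ℝ ∙ (w n k)) : E) = t • w n k := rfl
        simp only [LinearMap.smul_apply, LinearEquiv.coe_coe, LinearEquiv.symm_apply_apply,
          smul_eq_mul, this, map_smul_eq_mul, Real.norm_eq_abs]
        rw [mul_comm]
        exact mul_le_mul_of_nonneg_right (le_abs_self t) (apply_nonneg _ _))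
    refine ⟨g, ?_, hg2⟩
    have h1 := hg1 (e 1)
    have h2 : ((e 1 : ℝ ∙ (w n k)) : E) = w n k := by
      change (1 : ℝ) • w n k = w n k
      simp
    rw [h2] at h1
    simpa using h1
  let a : ℝ := ((k + 1 : ℝ) - r⁻¹ * g (x n)) / ζ n (x n)
  refine ⟨n, k, r⁻¹ • g + a • ζ n, fun b hb => ?_, ?_, ?_⟩
  · simp only [add_apply, smul_apply, hn b hb, smul_eq_mul,
      mul_zero, add_zero, abs_mul, abs_inv, abs_of_pos hr]
    rw [inv_mul_le_iff₀ hr, mul_one]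
    exact (hg b).trans (hrB b hb).le
  · simp only [add_apply, smul_apply, smul_eq_mul, a]
    rw [div_mul_cancel₀ _ (hζx n)]
    linarith
  · simp only [add_apply, smul_apply, smul_eq_mul, hζw,
      mul_zero, add_zero, hgw]
    rw [le_inv_mul_iff₀ hr, mul_comm]
    exact hk.trans (hqw n k)

/-! ### Sequential spaces are Ascoli -/

/-- A compact set `K` of functions on a sequential space is equicontinuous, because evaluation
`X → C(K, ℝ)` is continuous on every compact subset of `X`. -/
theorem IsAscoliSpace.of_sequentialSpace {X : Type*} [TopologicalSpace X] [T35Space X]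
    [SequentialSpace X] : IsAscoliSpace X where
  t35Space := inferInstance
  equicontinuous K hK := by
    have : CompactSpace K := isCompact_iff_compactSpace.1 hK
    let ev : X → C(K, ℝ) := fun x => ⟨fun f => (f : C(X, ℝ)) x, by fun_prop⟩
    have hev : Continuous ev := by
      rw [continuous_def]
      intro U hU
      rw [CompactlyCoherentSpace.isOpen_iff]
      intro S hS
      have : CompactSpace S := isCompact_iff_compactSpace.1 hS
      let g : C(S × K, ℝ) := ⟨fun p => ((p.2 : C(X, ℝ)).restrict S) p.1, by
        have h1 : Continuous fun f : C(X, ℝ) => f.restrict S := ContinuousMap.continuous_restrict S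
        fun_prop⟩
      have hg : Continuous fun s : S => ev s := g.curry.continuous
      exact hU.preimage hg
    intro x₀
    rw [Metric.equicontinuousAt_iff_right]
    intro ε hε
    have h1 := (Metric.tendsto_nhds.1 (hev.tendsto x₀)) ε hε
    filter_upwards [h1] with x hx f
    rw [dist_comm]
    exact lt_of_le_of_lt (ContinuousMap.dist_apply_le_dist (f := ev x) (g := ev x₀) f) hx

/-! ### Locally convex inductive limits -/

/-- The topology defined by a single seminorm. -/
@[reducible] noncomputable def Seminorm.inducedTopology {E : Type*} [AddCommGroup E] [Module ℝ E]
    (p : Seminorm ℝ E) : TopologicalSpace E :=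
  SeminormFamily.moduleFilterBasis (𝕜 := ℝ) (fun _ : Unit => p) |>.topology

theorem Seminorm.withSeminorms_inducedTopology {E : Type*} [AddCommGroup E] [Module ℝ E]
    (p : Seminorm ℝ E) : @WithSeminorms ℝ E Unit _ _ _ (fun _ => p) p.inducedTopology :=
  @WithSeminorms.mk ℝ E Unit _ _ _ (fun _ => p) p.inducedTopology rfl

theorem Seminorm.continuous_inducedTopology {E : Type*} [AddCommGroup E] [Module ℝ E]
    (p : Seminorm ℝ E) : @Continuous E ℝ p.inducedTopology _ p :=
  @WithSeminorms.continuous_seminorm _ _ _ _ _ _ p.inducedTopology _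
    p.withSeminorms_inducedTopology ()

/-- A linear map is continuous for the topology of `p` once its composition with `p` is. -/
theorem Seminorm.continuous_to_inducedTopology {X E : Type*} [AddCommGroup E] [Module ℝ E]
    [AddCommGroup X] [Module ℝ X] [TopologicalSpace X] [IsTopologicalAddGroup X]
    (p : Seminorm ℝ E) (f : X →ₗ[ℝ] E) (hf : Continuous fun x => p (f x)) :
    @Continuous X E _ p.inducedTopology f := by
  let := p.inducedTopology
  exact WithSeminorms.continuous_of_continuous_comp p.withSeminorms_inducedTopology f fun _ => hf

section Limit

variable {ι : Type*} {E : Type*} [AddCommGroup E] [Module ℝ E] {X : ι → Type*}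
  (τ : ∀ i, TopologicalSpace (X i)) (f : ∀ i, X i → E)

theorem locallyConvexLimitTopology.isTopologicalAddGroup :
    @IsTopologicalAddGroup E (locallyConvexLimitTopology τ f) _ :=
  topologicalAddGroup_sInf fun _ ht => ht.2.1

theorem locallyConvexLimitTopology.continuousSMul :
    @ContinuousSMul ℝ E _ _ (locallyConvexLimitTopology τ f) :=
  continuousSMul_sInf fun _ ht => ht.2.2.1

theorem locallyConvexLimitTopology.locallyConvexSpace :
    @LocallyConvexSpace ℝ E _ _ _ _ (locallyConvexLimitTopology τ f) :=
  .sInf fun _ ht => ht.2.2.2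

theorem locallyConvexLimitTopology.continuous (i : ι) :
    @Continuous (X i) E (τ i) (locallyConvexLimitTopology τ f) (f i) :=
  continuous_sInf_rng.2 fun _ ht => ht.1 i

/-- A seminorm on a locally convex inductive limit is continuous once it is continuous on each
of the spaces of which the limit is formed. -/
theorem Seminorm.continuous_locallyConvexLimitTopology [∀ i, AddCommGroup (X i)]
    [∀ i, Module ℝ (X i)] (hτ : ∀ i, @IsTopologicalAddGroup (X i) (τ i) _) (g : ∀ i, X i →ₗ[ℝ] E)
    (p : Seminorm ℝ E) (hp : ∀ i, @Continuous (X i) ℝ (τ i) _ fun x => p (g i x)) :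
    @Continuous E ℝ (locallyConvexLimitTopology τ fun i => g i) _ p := by
  have hle : locallyConvexLimitTopology τ (fun i => g i) ≤ p.inducedTopology := by
    let := p.inducedTopology
    have hw := p.withSeminorms_inducedTopology
    refine sInf_le ⟨fun i => ?_, hw.topologicalAddGroup, hw.continuousSMul,
      hw.toLocallyConvexSpace⟩
    let := τ i
    have := hτ i
    exact p.continuous_to_inducedTopology (g i) (hp i)
  exact continuous_le_dom hle p.continuous_inducedTopology

end Limit

/-! ### Extension of seminorms and the steps of a strict (LF)-space -/

/-- Hahn–Banach for seminorms: a seminorm dominated by `r` on a subspace agrees there with a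
seminorm dominated by `r` everywhere. -/
theorem Seminorm.exists_extension_le {E : Type*} [AddCommGroup E] [Module ℝ E]
    (S : Submodule ℝ E) (p r : Seminorm ℝ E) (h : ∀ x ∈ S, p x ≤ r x) :
    ∃ q : Seminorm ℝ E, q ≤ r ∧ ∀ x ∈ S, q x = p x := by
  obtain ⟨π, hπ⟩ := S.subtype.exists_leftInverse_of_injective (by simp)
  have hπS : ∀ x ∈ S, ((π x : S) : E) = x := fun x hx =>
    congrArg Subtype.val (LinearMap.congr_fun hπ ⟨x, hx⟩)
  -- The seminorm `p'` agrees with `p` on `S` and with `r` on the complement `ker π` of `S`.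
  let p' : Seminorm ℝ E :=
    p.comp (S.subtype ∘ₗ π) + r.comp (LinearMap.id - S.subtype ∘ₗ π)
  have hp' : ∀ u, p' u = p (π u) + r (u - π u) := fun _ => rfl
  refine ⟨p' ⊓ r, inf_le_right, fun x hx => le_antisymm ?_ ?_⟩
  · have h1 : (p' ⊓ r) x ≤ p' x := (inf_le_left : p' ⊓ r ≤ p') x
    simpa [hp', hπS x hx] using h1
  · rw [Seminorm.inf_apply]
    refine le_ciInf fun u => ?_
    have hmem : x - π u ∈ S := S.sub_mem hx (π u).2
    calc p x = p ((π u : E) + (x - π u)) := by rw [add_sub_cancel]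
      _ ≤ p (π u) + p (x - π u) := map_add_le_add _ _ _
      _ ≤ p (π u) + r (x - π u) := by gcongr; exact h _ hmem
      _ = p (π u) + r ((u - π u) + (x - u)) := by congr 2; abel
      _ ≤ p (π u) + (r (u - π u) + r (x - u)) := by gcongr; exact map_add_le_add _ _ _
      _ = p' u + r (x - u) := by rw [hp']; ring

/-- One step of the extension: a seminorm continuous on a subspace `S` with topology induced from
`T ≥ S` can be changed outside `S` to become continuous on `T`. -/
theorem Seminorm.exists_continuous_extension {E : Type*} [AddCommGroup E] [Module ℝ E]
    {S T : Submodule ℝ E} (hST : S ≤ T) (tS : TopologicalSpace S) (tT : TopologicalSpace T)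
    (hind : tS = tT.induced (Submodule.inclusion hST)) (h1 : IsTopologicalAddGroup T)
    (h2 : ContinuousSMul ℝ T) (h3 : LocallyConvexSpace ℝ T) (p : Seminorm ℝ E)
    (hp : Continuous fun x : S => p x) :
    ∃ q : Seminorm ℝ E, (Continuous fun x : T => q x) ∧ ∀ x ∈ S, q x = p x := by
  have hi : IsInducing (Submodule.inclusion hST) := ⟨hind⟩
  obtain ⟨r, hr, hpr⟩ := Seminorm.exists_le_comp_of_isInducing (p := p.comp S.subtype)
    (f := Submodule.inclusion hST) hp hi
  obtain ⟨π, hπ⟩ := T.subtype.exists_leftInverse_of_injective (by simp)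
  have hπT : ∀ x : T, π x = x := fun x => LinearMap.congr_fun hπ x
  obtain ⟨q, hq, hqp⟩ := Seminorm.exists_extension_le S p (r.comp π) fun x hx => by
    have h4 := hpr ⟨x, hx⟩
    have h5 : π x = Submodule.inclusion hST ⟨x, hx⟩ := hπT ⟨x, hST hx⟩
    rw [Seminorm.comp_apply, h5]
    exact h4
  refine ⟨q, ?_, hqp⟩
  have : Continuous (q.comp T.subtype) := Seminorm.continuous_of_le hr fun x => by
    have := hq x
    rwa [Seminorm.comp_apply, hπT] at this
  exact this

/-- A seminorm on `E` whose restriction to `F n` is `τ n`-continuous can be changed outside `F n`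
into a seminorm whose restrictions to all `F m`, `m ≥ n`, are continuous. -/
theorem IsStrictLFSpace.exists_seminorm_extension {E : Type*} [AddCommGroup E] [Module ℝ E]
    (F : ℕ → Submodule ℝ E) (τ : ∀ n, TopologicalSpace (F n)) (hF : Monotone F)
    (hcov : ∀ x : E, ∃ n, x ∈ F n) (hFr : ∀ n, @IsFrechetSpace (F n) _ _ (τ n))
    (hstr : ∀ n, τ n = (τ (n + 1)).induced (Submodule.inclusion (hF n.le_succ)))
    (n : ℕ) (p : Seminorm ℝ E) (hp : @Continuous (F n) ℝ (τ n) _ fun x => p x) :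
    ∃ q : Seminorm ℝ E, (∀ m, @Continuous (F m) ℝ (τ m) _ fun x => q x) ∧
      ∀ x ∈ F n, q x = p x := by
  have step : ∀ (m : ℕ) (q : {q : Seminorm ℝ E // @Continuous (F m) ℝ (τ m) _ fun x => q x}),
      ∃ q' : {q : Seminorm ℝ E // @Continuous (F (m + 1)) ℝ (τ (m + 1)) _ fun x => q x},
        ∀ x ∈ F m, q'.1 x = q.1 x := fun m q => by
    obtain ⟨q', h1, h2⟩ := Seminorm.exists_continuous_extension (hF m.le_succ) (τ m) (τ (m + 1))
      (hstr m) (hFr _).1 (hFr _).2 (hFr _).3 q.1 q.2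
    exact ⟨⟨q', h1⟩, h2⟩
  choose ext hext using step
  let Q : ∀ j, {q : Seminorm ℝ E // @Continuous (F (n + j)) ℝ (τ (n + j)) _ fun x => q x} :=
    fun j => Nat.rec ⟨p, hp⟩ (fun j q => ext (n + j) q) j
  have hQs : ∀ j, ∀ x ∈ F (n + j), (Q (j + 1)).1 x = (Q j).1 x := fun j => hext (n + j) (Q j)
  have hQle : ∀ j k, j ≤ k → ∀ x ∈ F (n + j), (Q k).1 x = (Q j).1 x := by
    intro j k hjk
    induction k, hjk using Nat.le_induction with
    | base => exact fun _ _ => rfl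
    | succ k hk ih => exact fun x hx => (hQs k x (hF (by omega) hx)).trans (ih x hx)
  have hcov' : ∀ x : E, ∃ j, x ∈ F (n + j) := fun x => by
    obtain ⟨m, hm⟩ := hcov x
    exact ⟨m, hF (by omega) hm⟩
  choose N hN using hcov'
  -- The extensions stabilise on every `F m`, so that their limit is a seminorm.
  let q : E → ℝ := fun x => (Q (N x)).1 x
  have hq : ∀ j, ∀ x ∈ F (n + j), q x = (Q j).1 x := fun j x hx => by
    rcases le_total (N x) j with h | h
    · exact (hQle _ _ h x (hN x)).symm
    · exact hQle _ _ h x hx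
  refine ⟨Seminorm.of q (fun x y => ?_) fun a x => ?_, fun m => ?_, fun x hx => hq 0 x hx⟩
  · have hx : x ∈ F (n + max (N x) (N y)) := hF (by omega) (hN x)
    have hy : y ∈ F (n + max (N x) (N y)) := hF (by omega) (hN y)
    rw [hq _ _ hx, hq _ _ hy, hq _ _ (add_mem hx hy)]
    exact map_add_le_add _ _ _
  · rw [hq _ _ (hN x), hq _ _ ((F _).smul_mem a (hN x))]
    exact map_smul_eq_mul _ _ _
  · have hmono : ∀ j, @Continuous (F j) (F (j + 1)) (τ j) (τ (j + 1))
        (Submodule.inclusion (hF j.le_succ)) := fun j => by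
      rw [hstr j]
      exact continuous_induced_dom
    have key : ∀ k (hk : m ≤ k), @Continuous (F m) (F k) (τ m) (τ k)
        (Submodule.inclusion (hF hk)) := by
      intro k hk
      induction k, hk using Nat.le_induction with
      | base => exact @continuous_id _ (τ m)
      | succ k hk ih => exact @Continuous.comp _ _ _ (τ m) (τ k) (τ (k + 1)) _ _ (hmono k) ih
    have h1 : @Continuous (F (n + m)) ℝ (τ (n + m)) _ fun x => (Q m).1 x := (Q m).2
    have h2 := @Continuous.comp _ _ _ (τ m) (τ (n + m)) _ _ _ h1 (key (n + m) (by omega))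
    convert! h2 using 2 with x
    exact hq m _ (hF (by omega) x.2)

/-- A locally convex topology is determined by its continuous seminorms. -/
theorem le_of_forall_continuous_seminorm {X : Type*} [AddCommGroup X] [Module ℝ X]
    (t t' : TopologicalSpace X) (h1 : @IsTopologicalAddGroup X t _)
    (h2 : @ContinuousSMul ℝ X _ _ t) (h3 : @LocallyConvexSpace ℝ X _ _ _ _ t)
    (h4 : @IsTopologicalAddGroup X t' _)
    (h : ∀ p : Seminorm ℝ X, @Continuous X ℝ t _ p → @Continuous X ℝ t' _ p) : t' ≤ t := by
  have hw := @PolynormableSpace.withSeminorms ℝ X _ _ _ t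
    (by let := t; exact LocallyConvexSpace.toPolynormableSpace)
  rw [← continuous_id_iff_le]
  exact @WithSeminorms.continuous_of_continuous_comp ℝ ℝ X X _ _ _ _ _ _ _ _ _ _ t' h4 t hw
    LinearMap.id fun p => h p.1 p.2

/-- The topology of a strict (LF)-space induces the given topologies on the spaces of which it is
the limit. -/
theorem IsStrictLFSpace.topology_eq_induced {E : Type*} [AddCommGroup E] [Module ℝ E]
    (F : ℕ → Submodule ℝ E) (τ : ∀ n, TopologicalSpace (F n)) (hF : Monotone F)
    (hcov : ∀ x : E, ∃ n, x ∈ F n) (hFr : ∀ n, @IsFrechetSpace (F n) _ _ (τ n))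
    (hstr : ∀ n, τ n = (τ (n + 1)).induced (Submodule.inclusion (hF n.le_succ))) (n : ℕ) :
    τ n = (locallyConvexLimitTopology τ fun n (x : F n) => (x : E)).induced Subtype.val := by
  have hlim := locallyConvexLimitTopology.isTopologicalAddGroup τ fun n (x : F n) => (x : E)
  refine le_antisymm ?_ ?_
  · rw [← continuous_iff_le_induced]
    exact locallyConvexLimitTopology.continuous τ (fun n (x : F n) => (x : E)) n
  · refine le_of_forall_continuous_seminorm _ _ (hFr n).1 (hFr n).2 (hFr n).3
      (by
        let := locallyConvexLimitTopology τ fun n (x : F n) => (x : E)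
        exact topologicalAddGroup_induced (F n).subtype) fun p hp => ?_
    -- A `τ n`-continuous seminorm is the restriction of a continuous seminorm on `E`.
    obtain ⟨π, hπ⟩ := (F n).subtype.exists_leftInverse_of_injective (by simp)
    have hπF : ∀ x : F n, π x = x := fun x => LinearMap.congr_fun hπ x
    obtain ⟨q, hq1, hq2⟩ := IsStrictLFSpace.exists_seminorm_extension F τ hF hcov hFr hstr n
      (p.comp π) (by simpa [hπF] using! hp)
    have hq3 := q.continuous_locallyConvexLimitTopology τ (fun n => (hFr n).1)
      (fun n => (F n).subtype) hq1
    have h4 := @Continuous.comp _ _ _ (_) (_) _ _ _ hq3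
      (@continuous_induced_dom _ _ (Subtype.val : F n → E)
        (locallyConvexLimitTopology τ fun n (x : F n) => (x : E)))
    convert! h4 using 1
    funext x
    simp [hq2 x x.2, hπF]

/-- The structure of a strict (LF)-space: the Fréchet spaces of which it is the union carry the
subspace topology, are closed, and a seminorm is continuous as soon as its restrictions to them
are. -/
theorem IsStrictLFSpace.exists_submodules {E : Type*} [AddCommGroup E] [Module ℝ E]
    [TopologicalSpace E] [T2Space E] (hE : IsStrictLFSpace E) :
    ∃ F : ℕ → Submodule ℝ E, Monotone F ∧ (∀ x : E, ∃ n, x ∈ F n) ∧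
      (∀ n, IsFrechetSpace (F n)) ∧ (∀ n, IsClosed (F n : Set E)) ∧
      ∀ p : Seminorm ℝ E, (∀ n, Continuous fun x : F n => p x) → Continuous p := by
  obtain ⟨F, τ, hF, hcov, hFr, hstr, htop⟩ := hE
  have hcontp : ∀ p : Seminorm ℝ E, (∀ n, @Continuous (F n) ℝ (τ n) _ fun x => p x) →
      Continuous p := fun p hp => by
    rw [htop]
    exact p.continuous_locallyConvexLimitTopology τ (fun n => (hFr n).1)
      (fun n => (F n).subtype) hp
  have hTAG : IsTopologicalAddGroup E :=
    htop ▸ locallyConvexLimitTopology.isTopologicalAddGroup τ _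
  obtain rfl : τ = fun n => instTopologicalSpaceSubtype := funext fun n => by
    rw [IsStrictLFSpace.topology_eq_induced F τ hF hcov hFr hstr n, ← htop]
    rfl
  refine ⟨F, hF, hcov, hFr, fun n => ?_, hcontp⟩
  let := IsTopologicalAddGroup.rightUniformSpace E
  have : IsUniformAddGroup E := isUniformAddGroup_of_addCommGroup
  have h1 := (hFr n).completeSpace
  have h2 : IsUniformAddGroup (F n) := (F n).toAddSubgroup.isUniformAddGroup
  rw [IsUniformAddGroup.rightUniformSpace_eq] at h1
  exact (completeSpace_coe_iff_isComplete.1 h1).isClosed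

/-! ### Montel spaces with a growing sequence of closed subspaces -/

/-- A point outside a closed subspace is separated from it by a functional vanishing on it. -/
theorem Submodule.exists_strongDual_eq_zero_ne_zero {E : Type*} [AddCommGroup E] [Module ℝ E]
    [TopologicalSpace E] [IsTopologicalAddGroup E] [ContinuousSMul ℝ E] [LocallyConvexSpace ℝ E]
    (S : Submodule ℝ E) (hS : IsClosed (S : Set E)) {x : E} (hx : x ∉ S) :
    ∃ ζ : StrongDual ℝ E, (∀ y ∈ S, ζ y = 0) ∧ ζ x ≠ 0 := by
  obtain ⟨f, u, h1, h2⟩ := geometric_hahn_banach_closed_point S.convex hS hx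
  have hu : 0 < u := by simpa using h1 0 S.zero_mem
  refine ⟨f, fun y hy => ?_, (hu.trans h2).ne'⟩
  by_contra hne
  have h3 := h1 ((u / f y) • y) (S.smul_mem _ hy)
  rw [map_smul, smul_eq_mul, div_mul_cancel₀ _ hne] at h3
  exact lt_irrefl _ h3

/-- On a barrelled space, the weighted supremum of pointwise finitely supported functionals is
a continuous seminorm. -/
theorem exists_continuous_seminorm_ge {E : Type*} [AddCommGroup E] [Module ℝ E]
    [TopologicalSpace E] [IsTopologicalAddGroup E] [ContinuousSMul ℝ E] [BarrelledSpace ℝ E]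
    (ζ : ℕ → StrongDual ℝ E) (hζ : ∀ x, ∃ m, ∀ n, m ≤ n → ζ n x = 0) (c : ℕ → ℝ) :
    ∃ p : Seminorm ℝ E, Continuous p ∧ ∀ n x, c n * |ζ n x| ≤ p x := by
  let q : ℕ → Seminorm ℝ E := fun n => (c n • ζ n).toSeminorm
  have hq : ∀ n x, q n x = |c n| * |ζ n x| := fun n x => by
    change ‖(c n • ζ n) x‖ = _
    simp
  have hbdd : ∀ x, BddAbove (range fun n => q n x) := fun x => by
    obtain ⟨m, hm⟩ := hζ x
    refine (((Finset.range m).finite_toSet.image fun n => q n x).insert 0 |>.bddAbove).mono ?_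
    rintro _ ⟨n, rfl⟩
    rcases lt_or_ge n m with h | h
    · exact Or.inr ⟨n, by simpa using h, rfl⟩
    · exact Or.inl (by simp [hq, hm n h])
  have hbdd' : BddAbove (range q) := Seminorm.bddAbove_range_iff.2 hbdd
  refine ⟨⨆ n, q n, ?_, fun n x => ?_⟩
  · rw [Seminorm.coe_iSup_eq hbdd']
    exact Seminorm.continuous_iSup q (fun n => (c n • ζ n).continuous.norm) hbdd'
  · rw [Seminorm.coe_iSup_eq hbdd', iSup_apply]
    refine le_trans ?_ (le_ciSup (hbdd x) n)
    rw [hq]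
    exact mul_le_mul_of_nonneg_right (le_abs_self _) (abs_nonneg _)

/-- In a Montel space the neighbourhoods of `0` in a closed infinite-dimensional subspace are
unbounded. -/
theorem MontelSpace.not_isVonNBounded_image {E : Type*} [AddCommGroup E] [Module ℝ E]
    [TopologicalSpace E] [IsTopologicalAddGroup E] [ContinuousSMul ℝ E] [T2Space E]
    [MontelSpace ℝ E] (S : Submodule ℝ E) (hS : IsClosed (S : Set E))
    (hdim : ¬ FiniteDimensional ℝ S) {V : Set S} (hV : V ∈ 𝓝 0) :
    ¬ IsVonNBounded ℝ (Subtype.val '' V : Set E) := by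
  intro hb
  have hc := MontelSpace.isCompact_of_isClosed_of_isVonNBounded ℝ isClosed_closure hb.closure
  have hc' : IsCompact (Subtype.val ⁻¹' closure (Subtype.val '' V : Set E) : Set S) :=
    hS.isClosedEmbedding_subtypeVal.isCompact_preimage hc
  have hmem : (Subtype.val ⁻¹' closure (Subtype.val '' V : Set E) : Set S) ∈ 𝓝 0 :=
    mem_of_superset hV fun v hv => subset_closure ⟨v, hv, rfl⟩
  have : LocallyCompactSpace S := hc'.locallyCompactSpace_of_mem_nhds_of_addGroup hmem
  exact hdim (FiniteDimensional.of_locallyCompactSpace ℝ)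

/-- If a barrelled Montel space is the union of a strictly growing sequence of closed subspaces,
the first of which is metrizable and infinite-dimensional, then its strong dual is not Ascoli. -/
theorem not_isAscoliSpace_of_submodules {E : Type*} [AddCommGroup E] [Module ℝ E]
    [TopologicalSpace E] [IsTopologicalAddGroup E] [ContinuousSMul ℝ E] [LocallyConvexSpace ℝ E]
    [T2Space E] [MontelSpace ℝ E] [BarrelledSpace ℝ E] (F : ℕ → Submodule ℝ E) (hF : Monotone F)
    (hcov : ∀ x : E, ∃ n, x ∈ F n) (hcl : ∀ n, IsClosed (F n : Set E)) (hne : ∀ n, F n ≠ ⊤)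
    [FirstCountableTopology (F 0)] (hdim : ¬ FiniteDimensional ℝ (F 0)) :
    ¬ IsAscoliSpace (StrongDual ℝ E) := by
  have hx : ∀ n, ∃ x, x ∉ F n := fun n => by
    by_contra! h
    exact hne n (eq_top_iff.2 fun x _ => h x)
  choose x hx using hx
  choose ζ hζF hζx using fun n => (F n).exists_strongDual_eq_zero_ne_zero (hcl n) (hx n)
  obtain ⟨V, hV⟩ := (𝓝 (0 : F 0)).exists_antitone_basis
  have hq : ∀ n, ∃ q : Seminorm ℝ E, Continuous q ∧ ∀ k : ℕ, ∃ y ∈ V n, (k : ℝ) ≤ q y := by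
    intro n
    have h1 := MontelSpace.not_isVonNBounded_image (F 0) (hcl 0) hdim (hV.mem n)
    rw [(PolynormableSpace.withSeminorms ℝ E).isVonNBounded_iff_seminorm_bounded] at h1
    push Not at h1
    obtain ⟨⟨q, hq⟩, h2⟩ := h1
    refine ⟨q, hq, fun k => ?_⟩
    obtain ⟨_, ⟨y, hy, rfl⟩, h3⟩ := h2 (k + 1) (by positivity)
    exact ⟨y, hy, by linarith⟩
  choose q hqc w hwV hqw using hq
  refine not_isAscoliSpace_strongDual_of_functionals x (fun n k => w n k) ζ q (fun κ => ?_) hqc hqw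
    hζx (fun n k => hζF n _ (hF (Nat.zero_le n) (w n k).2)) (exists_continuous_seminorm_ge ζ ?_)
  · -- `w n (κ n) ∈ V n` tends to zero.
    have h1 : Tendsto (fun n => w n (κ n)) atTop (𝓝 0) := hV.tendsto fun n => hwV n _
    have h2 : Tendsto (fun n => (w n (κ n) : E)) atTop (𝓝 0) :=
      (continuous_subtype_val.tendsto (0 : F 0)).comp h1
    exact h2.isVonNBounded_range ℝ
  · intro y
    obtain ⟨m, hm⟩ := hcov y
    exact ⟨m, fun n hn => hζF n y (hF hn hm)⟩

theorem IsFrechetSpace.of_eq_top {E : Type*} [AddCommGroup E] [Module ℝ E]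
    [TopologicalSpace E] [IsTopologicalAddGroup E] [ContinuousSMul ℝ E] [LocallyConvexSpace ℝ E]
    (S : Submodule ℝ E) (hS : IsFrechetSpace S) (htop : S = ⊤) : IsFrechetSpace E := by
  subst htop
  refine ⟨inferInstance, inferInstance, inferInstance, ?_, ?_⟩
  · have := hS.metrizableSpace
    exact (Homeomorph.Set.univ E).symm.isEmbedding.metrizableSpace
  · let := IsTopologicalAddGroup.rightUniformSpace E
    have : IsUniformAddGroup E := isUniformAddGroup_of_addCommGroup
    have h1 := hS.completeSpace
    have h2 : IsUniformAddGroup (⊤ : Submodule ℝ E) :=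
      (⊤ : Submodule ℝ E).toAddSubgroup.isUniformAddGroup
    rw [IsUniformAddGroup.rightUniformSpace_eq] at h1
    exact completeSpace_iff_isComplete_univ.2 (completeSpace_coe_iff_isComplete.1 h1)

/-! ### The space `φ` and its strong dual -/

instance Phi.instIsTopologicalAddGroup : IsTopologicalAddGroup Phi :=
  locallyConvexLimitTopology.isTopologicalAddGroup _ _

instance Phi.instContinuousSMul : ContinuousSMul ℝ Phi :=
  locallyConvexLimitTopology.continuousSMul _ _

instance Phi.instLocallyConvexSpace : LocallyConvexSpace ℝ Phi :=
  locallyConvexLimitTopology.locallyConvexSpace _ _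

/-- The embedding `ℝⁿ → φ` as a linear map. -/
noncomputable def Phi.ofFinₗ (n : ℕ) : (Fin n → ℝ) →ₗ[ℝ] Phi :=
  show (Fin n → ℝ) →ₗ[ℝ] (ℕ →₀ ℝ) from
    ∑ i : Fin n, Finsupp.lsingle (i : ℕ) ∘ₗ LinearMap.proj i

theorem Phi.coe_ofFinₗ (n : ℕ) : (Phi.ofFinₗ n : (Fin n → ℝ) → Phi) = Phi.ofFin n := by
  funext x
  change (∑ i : Fin n, Finsupp.lsingle (i : ℕ) ∘ₗ LinearMap.proj i :
    (Fin n → ℝ) →ₗ[ℝ] (ℕ →₀ ℝ)) x = _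
  simp [Phi.ofFin, LinearMap.sum_apply]
  rfl

/-- Seminorms on finite-dimensional Hausdorff spaces are continuous. -/
theorem Seminorm.continuous_of_finiteDimensional_t2 {X : Type*} [AddCommGroup X] [Module ℝ X]
    [tX : TopologicalSpace X] [IsTopologicalAddGroup X] [ContinuousSMul ℝ X] [T2Space X]
    [FiniteDimensional ℝ X] (p : Seminorm ℝ X) : Continuous p := by
  have hw := p.withSeminorms_inducedTopology
  have h1 : @Continuous X X tX p.inducedTopology (LinearMap.id : X →ₗ[ℝ] X) :=
    @LinearMap.continuous_of_finiteDimensional ℝ _ X _ _ _ _ _ X _ _ p.inducedTopology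
      (@WithSeminorms.topologicalAddGroup _ _ _ _ _ _ p.inducedTopology _ hw)
      (@WithSeminorms.continuousSMul _ _ _ _ _ _ p.inducedTopology _ hw) _ _ _ LinearMap.id
  exact @Continuous.comp _ _ _ tX p.inducedTopology _ _ _ p.continuous_inducedTopology h1

/-- `φ` carries its finest locally convex topology. -/
theorem Phi.continuous_seminorm (p : Seminorm ℝ Phi) : Continuous p := by
  have h := p.continuous_locallyConvexLimitTopology (X := fun n : ℕ => Fin n → ℝ)
    (fun _ => inferInstance) (fun _ => inferInstance) Phi.ofFinₗ fun n =>
      (p.comp (Phi.ofFinₗ n)).continuous_of_finiteDimensional_t2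
  have e : (fun n => ⇑(Phi.ofFinₗ n)) = Phi.ofFin := funext Phi.coe_ofFinₗ
  rw [e] at h
  exact h

/-- Linear maps out of a space on which all seminorms are continuous are continuous. -/
theorem LinearMap.continuous_of_forall_seminorm {X Y : Type*} [AddCommGroup X] [Module ℝ X]
    [TopologicalSpace X] [IsTopologicalAddGroup X] [AddCommGroup Y] [Module ℝ Y]
    [TopologicalSpace Y] [IsTopologicalAddGroup Y] [ContinuousSMul ℝ Y] [LocallyConvexSpace ℝ Y]
    (hX : ∀ p : Seminorm ℝ X, Continuous p) (f : X →ₗ[ℝ] Y) : Continuous f :=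
  WithSeminorms.continuous_of_continuous_comp (PolynormableSpace.withSeminorms ℝ Y) f
    fun p => hX (p.1.comp f)

/-- A strict (LF)-space that is a proper union of finite-dimensional subspaces is `φ`. -/
theorem nonempty_continuousLinearEquiv_phi {E : Type*} [AddCommGroup E] [Module ℝ E]
    [TopologicalSpace E] [IsTopologicalAddGroup E] [ContinuousSMul ℝ E] [LocallyConvexSpace ℝ E]
    [T2Space E] (F : ℕ → Submodule ℝ E) (hF : Monotone F)
    (hcov : ∀ x : E, ∃ n, x ∈ F n) (hne : ∀ n, F n ≠ ⊤) (hdim : ∀ n, FiniteDimensional ℝ (F n))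
    (hsem : ∀ p : Seminorm ℝ E, (∀ n, Continuous fun x : F n => p x) → Continuous p) :
    Nonempty (E ≃L[ℝ] Phi) := by
  have hsem' : ∀ p : Seminorm ℝ E, Continuous p := fun p => hsem p fun n =>
    (p.comp (F n).subtype).continuous_of_finiteDimensional_t2
  obtain ⟨⟨ι, b⟩⟩ := Module.Free.exists_basis (R := ℝ) (M := E)
  -- The subspace `F n` contains only finitely many basis vectors.
  have hfin : ∀ n, {i | b i ∈ F n}.Finite := fun n => by
    have hli : LinearIndependent ℝ (fun i : {i | b i ∈ F n} => (⟨b i, i.2⟩ : F n)) := by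
      refine LinearIndependent.of_comp (F n).subtype ?_
      exact b.linearIndependent.comp _ Subtype.val_injective
    have := hli.finite
    exact Set.toFinite _
  have hcount : Countable ι := by
    rw [← Set.countable_univ_iff]
    refine (countable_iUnion fun n => (hfin n).countable).mono fun i _ => ?_
    obtain ⟨n, hn⟩ := hcov (b i)
    exact mem_iUnion.2 ⟨n, hn⟩
  have hinf : Infinite ι := by
    by_contra hι
    rw [not_infinite_iff_finite] at hι
    choose N hN using fun i => hcov (b i)
    obtain ⟨M, hM⟩ := (Set.finite_range N).bddAbove
    refine hne M (eq_top_iff.2 ?_)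
    rw [← b.span_eq, Submodule.span_le]
    rintro _ ⟨i, rfl⟩
    exact hF (hM ⟨i, rfl⟩) (hN i)
  obtain ⟨e⟩ := nonempty_equiv_of_countable (α := ι) (β := ℕ)
  let L : E ≃ₗ[ℝ] Phi := (b.reindex e).repr
  exact ⟨{ L with
    continuous_toFun := LinearMap.continuous_of_forall_seminorm hsem' L.toLinearMap
    continuous_invFun :=
      LinearMap.continuous_of_forall_seminorm Phi.continuous_seminorm L.symm.toLinearMap }⟩

/-- The unit vectors of `φ`. -/
noncomputable def Phi.unit (n : ℕ) : Phi := (Finsupp.single n 1 : ℕ →₀ ℝ)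

/-- The coordinate functionals of `φ`. -/
noncomputable def Phi.coord (n : ℕ) : StrongDual ℝ Phi where
  toLinearMap := (Finsupp.lapply n : (ℕ →₀ ℝ) →ₗ[ℝ] ℝ)
  cont := LinearMap.continuous_of_forall_seminorm Phi.continuous_seminorm
    (Finsupp.lapply n : (ℕ →₀ ℝ) →ₗ[ℝ] ℝ)

theorem Phi.exists_coord_eq_zero (x : Phi) : ∃ m, ∀ n, m ≤ n → Phi.coord n x = 0 := by
  let y : ℕ →₀ ℝ := x
  refine ⟨y.support.sup id + 1, fun n hn => ?_⟩
  by_contra h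
  have h1 : n ≤ y.support.sup id := Finset.le_sup (f := id) (Finsupp.mem_support_iff.2 h)
  omega

theorem Phi.sum_coord_smul_unit (x : Phi) {m : ℕ} (h : ∀ n, m ≤ n → Phi.coord n x = 0) :
    ∑ n ∈ Finset.range m, Phi.coord n x • Phi.unit n = x := by
  let y : ℕ →₀ ℝ := x
  change ∑ n ∈ Finset.range m, y n • (Finsupp.single n 1 : ℕ →₀ ℝ) = y
  have hsub : y.support ⊆ Finset.range m := fun n hn => by
    rw [Finset.mem_range]
    by_contra hcon
    exact Finsupp.mem_support_iff.1 hn (h n (not_lt.1 hcon))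
  simp only [Finsupp.smul_single, smul_eq_mul, mul_one]
  conv_rhs => rw [← Finsupp.sum_single y]
  rw [Finsupp.sum_of_support_subset y hsub _ (by simp)]

/-- A bounded subset of `φ` lies in one of the spaces `ℝⁿ`. -/
theorem Phi.exists_coord_eq_zero_of_isVonNBounded {B : Set Phi} (hB : IsVonNBounded ℝ B) :
    ∃ m, ∀ n, m ≤ n → ∀ x ∈ B, Phi.coord n x = 0 := by
  by_contra! hcon
  choose g hg b hbB hb using hcon
  -- Otherwise the coordinates `g 0, g 1, …` would all be nonzero somewhere on `B`.
  have hsparse : ∀ x, ∃ m, ∀ n, m ≤ n → Phi.coord (g n) x = 0 := fun x => by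
    obtain ⟨m, hm⟩ := Phi.exists_coord_eq_zero x
    exact ⟨m, fun n hn => hm _ (hn.trans (hg n))⟩
  have hbar : BarrelledSpace ℝ Phi := ⟨fun p _ => Phi.continuous_seminorm p⟩
  obtain ⟨n, hn⟩ := exists_forall_apply_eq_zero (fun n => Phi.coord (g n))
    (exists_continuous_seminorm_ge _ hsparse) hB
  exact hb n (hn _ (hbB n))

/-- Linear functionals on `φ` correspond to arbitrary real sequences. -/
noncomputable def Phi.strongDualLinearEquiv : StrongDual ℝ Phi ≃ₗ[ℝ] (ℕ → ℝ) where
  toFun χ n := χ (Phi.unit n)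
  map_add' _ _ := rfl
  map_smul' _ _ := rfl
  invFun a :=
    { toLinearMap := (Finsupp.linearCombination ℝ a : (ℕ →₀ ℝ) →ₗ[ℝ] ℝ)
      cont := LinearMap.continuous_of_forall_seminorm Phi.continuous_seminorm
        (Finsupp.linearCombination ℝ a : (ℕ →₀ ℝ) →ₗ[ℝ] ℝ) }
  left_inv χ := by
    refine ContinuousLinearMap.ext fun x => ?_
    exact LinearMap.congr_fun (Finsupp.lhom_ext' (M := ℝ) (R := ℝ)
      (φ := (Finsupp.linearCombination ℝ fun n => χ (Phi.unit n) : (ℕ →₀ ℝ) →ₗ[ℝ] ℝ))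
      (ψ := (χ : Phi →ₗ[ℝ] ℝ)) fun n => LinearMap.ext_ring (by simp; rfl)) x
  right_inv a := by
    funext n
    change (Finsupp.linearCombination ℝ a : (ℕ →₀ ℝ) →ₗ[ℝ] ℝ) (Finsupp.single n 1) = a n
    simp

theorem Phi.strongDualLinearEquiv_symm_unit (a : ℕ → ℝ) (n : ℕ) :
    Phi.strongDualLinearEquiv.symm a (Phi.unit n) = a n :=
  congrFun (Phi.strongDualLinearEquiv.apply_symm_apply a) n

theorem Phi.continuous_strongDualLinearEquiv_symm :
    Continuous Phi.strongDualLinearEquiv.symm := by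
  refine continuous_of_continuousAt_zero Phi.strongDualLinearEquiv.symm ?_
  rw [ContinuousAt, map_zero]
  intro U hU
  obtain ⟨B, hB, hBU⟩ := StrongDual.exists_polar_subset hU
  obtain ⟨m, hm⟩ := Phi.exists_coord_eq_zero_of_isVonNBounded hB
  obtain ⟨M, hM0, hM⟩ : ∃ M : ℝ, 0 ≤ M ∧ ∀ b ∈ B, ∀ n < m, |Phi.coord n b| ≤ M := by
    have h1 := (PolynormableSpace.withSeminorms ℝ Phi).isVonNBounded_iff_seminorm_bounded.1 hB
    choose r hr hrB using fun n => h1 ⟨(Phi.coord n).toSeminorm, (Phi.coord n).continuous.norm⟩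
    refine ⟨∑ n ∈ Finset.range m, r n, Finset.sum_nonneg fun n _ => (hr n).le,
      fun b hb n hn => (hrB n b hb).le.trans ?_⟩
    exact Finset.single_le_sum (fun n _ => (hr n).le) (Finset.mem_range.2 hn)
  have hδ : 0 < (m * M + 1)⁻¹ := by positivity
  have hnhds : ∀ᶠ a : ℕ → ℝ in 𝓝 0, ∀ n ∈ Finset.range m, |a n| < (m * M + 1)⁻¹ := by
    rw [Filter.eventually_all_finset]
    intro n _
    have h2 : Tendsto (fun a : ℕ → ℝ => |a n|) (𝓝 0) (𝓝 0) :=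
      ((continuous_apply n).abs.tendsto' 0 0 (by simp))
    exact h2.eventually_lt_const hδ
  rw [Filter.mem_map]
  filter_upwards [hnhds] with a ha
  refine hBU _ fun b hb => ?_
  rw [← Phi.sum_coord_smul_unit b fun n hn => hm n hn b hb, map_sum]
  calc |∑ n ∈ Finset.range m, Phi.strongDualLinearEquiv.symm a (Phi.coord n b • Phi.unit n)|
      ≤ ∑ n ∈ Finset.range m, M * (m * M + 1)⁻¹ := by
        refine (Finset.abs_sum_le_sum_abs _ _).trans (Finset.sum_le_sum fun n hn => ?_)
        rw [map_smul, Phi.strongDualLinearEquiv_symm_unit, smul_eq_mul, abs_mul]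
        exact mul_le_mul (hM b hb n (Finset.mem_range.1 hn)) (ha n hn).le (abs_nonneg _) hM0
    _ = (m * M) / (m * M + 1) := by
        rw [Finset.sum_const, Finset.card_range, nsmul_eq_mul, div_eq_mul_inv, mul_assoc]
    _ ≤ 1 := (div_le_one (by positivity)).2 (by linarith)

/-- The strong dual of `φ` is `ℝ^ω`. -/
noncomputable def Phi.strongDualEquiv : StrongDual ℝ Phi ≃L[ℝ] (ℕ → ℝ) where
  toLinearEquiv := Phi.strongDualLinearEquiv
  continuous_toFun := by
    refine continuous_pi fun n => ?_
    change Continuous fun χ : StrongDual ℝ Phi => χ (Phi.unit n)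
    fun_prop
  continuous_invFun := Phi.continuous_strongDualLinearEquiv_symm

/-! ### Duals of metrizable Montel spaces -/

theorem Seminorm.le_of_forall_lt_one {E : Type*} [AddCommGroup E] [Module ℝ E]
    {p q : Seminorm ℝ E} (h : ∀ x, q x < 1 → p x < 1) : p ≤ q := by
  intro x
  by_contra hcon
  obtain ⟨t, ht1, ht2⟩ := exists_between (not_le.1 hcon)
  have ht : 0 < t := lt_of_le_of_lt (apply_nonneg q x) ht1
  have h1 := h (t⁻¹ • x)
  simp only [map_smul_eq_mul, norm_inv, Real.norm_eq_abs, abs_of_pos ht] at h1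
  rw [inv_mul_lt_iff₀ ht, inv_mul_lt_iff₀ ht, mul_one] at h1
  exact absurd (h1 ht1) (not_lt.2 ht2.le)

theorem exists_continuous_seminorm_of_mem_nhds {E : Type*} [AddCommGroup E] [Module ℝ E]
    [TopologicalSpace E] [IsTopologicalAddGroup E] [ContinuousSMul ℝ E] [LocallyConvexSpace ℝ E]
    {U : Set E} (hU : U ∈ 𝓝 (0 : E)) :
    ∃ r : Seminorm ℝ E, Continuous r ∧ ∀ x, r x < 1 → x ∈ U := by
  have hw := PolynormableSpace.withSeminorms ℝ E
  obtain ⟨⟨s, ε⟩, hε, hs⟩ := hw.hasBasis_zero_ball.mem_iff.1 hU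
  have hε' : 0 < ε := hε
  let p := s.sup fun p : {p : Seminorm ℝ E // Continuous p} => p.1
  have hp : Continuous p := Seminorm.continuous (r := ε)
    (hw.hasBasis_zero_ball.mem_of_mem (i := (s, ε)) hε)
  refine ⟨p.comp (ε⁻¹ • LinearMap.id), ?_, fun x hx => hs ?_⟩
  · change Continuous fun x => p (ε⁻¹ • x)
    fun_prop
  · rw [Seminorm.mem_ball_zero]
    change p (ε⁻¹ • x) < 1 at hx
    rwa [map_smul_eq_mul, norm_inv, Real.norm_eq_abs, abs_of_pos hε', inv_mul_lt_iff₀ hε',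
      mul_one] at hx

/-- The topology of a first countable locally convex space is given by an increasing sequence of
seminorms, cofinal among the continuous ones. -/
theorem exists_monotone_seminorm_seq (E : Type*) [AddCommGroup E] [Module ℝ E]
    [TopologicalSpace E] [IsTopologicalAddGroup E] [ContinuousSMul ℝ E] [LocallyConvexSpace ℝ E]
    [FirstCountableTopology E] :
    ∃ q : ℕ → Seminorm ℝ E, Monotone q ∧ (∀ n, Continuous (q n)) ∧
      ∀ p : Seminorm ℝ E, Continuous p → ∃ n, p ≤ q n := by
  obtain ⟨U, hU⟩ := (𝓝 (0 : E)).exists_antitone_basis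
  choose r hrc hrU using fun n => exists_continuous_seminorm_of_mem_nhds (hU.mem n)
  refine ⟨partialSups r, (partialSups r).monotone, fun n => ?_, fun p hp => ?_⟩
  · induction n with
    | zero => simpa using hrc 0
    | succ n ih =>
      rw [partialSups_add_one]
      exact ih.sup (hrc (n + 1))
  · obtain ⟨n, hn⟩ := hU.mem_iff.1 ((Seminorm.continuous_iff one_pos).1 hp)
    refine ⟨n, (Seminorm.le_of_forall_lt_one fun x hx => ?_).trans (le_partialSups r n)⟩
    simpa [Seminorm.mem_ball_zero] using hn (hrU n x hx)

/-- The functionals dominated by a seminorm, i.e. the polar of its unit ball. -/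
def Seminorm.dualBall {E : Type*} [AddCommGroup E] [Module ℝ E] [TopologicalSpace E]
    (q : Seminorm ℝ E) : Set (StrongDual ℝ E) := {χ | ∀ x, |χ x| ≤ q x}

theorem Seminorm.dualBall_mono {E : Type*} [AddCommGroup E] [Module ℝ E] [TopologicalSpace E]
    {p q : Seminorm ℝ E} (h : p ≤ q) : p.dualBall ⊆ q.dualBall :=
  fun _ hχ x => (hχ x).trans (h x)

theorem Seminorm.mem_dualBall_of_forall_le_one {E : Type*} [AddCommGroup E] [Module ℝ E]
    [TopologicalSpace E] {q : Seminorm ℝ E} {χ : StrongDual ℝ E}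
    (h : ∀ x, q x ≤ 1 → |χ x| ≤ 1) : χ ∈ q.dualBall := by
  intro x
  by_contra hcon
  obtain ⟨t, ht1, ht2⟩ := exists_between (not_le.1 hcon)
  have ht : 0 < t := lt_of_le_of_lt (apply_nonneg q x) ht1
  have h1 := h (t⁻¹ • x)
  simp only [map_smul_eq_mul, map_smul, smul_eq_mul, abs_mul, norm_inv, Real.norm_eq_abs, abs_inv,
    abs_of_pos ht] at h1
  rw [inv_mul_le_iff₀ ht, inv_mul_le_iff₀ ht, mul_one] at h1
  exact absurd (h1 ht1.le) (not_le.2 ht2)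

/-- Alaoglu–Bourbaki for Montel spaces: polars of neighbourhoods are strongly compact, since
on equicontinuous sets pointwise convergence implies uniform convergence on compact sets. -/
theorem Seminorm.isCompact_dualBall {E : Type*} [AddCommGroup E] [Module ℝ E]
    [TopologicalSpace E] [IsTopologicalAddGroup E] [ContinuousSMul ℝ E] [T2Space E]
    [MontelSpace ℝ E] {q : Seminorm ℝ E} (hq : Continuous q) : IsCompact q.dualBall := by
  let P : Set (E → ℝ) := {f | (∀ x y, f (x + y) = f x + f y) ∧ (∀ (a : ℝ) x, f (a • x) = a * f x) ∧
    ∀ x, f x ∈ Icc (-q x) (q x)}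
  have hP : IsCompact P := by
    refine (isCompact_univ_pi fun x => isCompact_Icc (a := -q x) (b := q x)).of_isClosed_subset
      ?_ fun f hf x _ => hf.2.2 x
    have h1 : P = (⋂ x, ⋂ y, {f | f (x + y) = f x + f y}) ∩
        ((⋂ a : ℝ, ⋂ x, {f | f (a • x) = a * f x}) ∩ ⋂ x, {f | f x ∈ Icc (-q x) (q x)}) := by
      ext f
      simp [P]
    rw [h1]
    refine (isClosed_iInter fun x => isClosed_iInter fun y => ?_).inter
      ((isClosed_iInter fun a => isClosed_iInter fun x => ?_).inter (isClosed_iInter fun x => ?_))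
    · exact isClosed_eq (by fun_prop) (by fun_prop)
    · exact isClosed_eq (by fun_prop) (by fun_prop)
    · exact isClosed_Icc.preimage (continuous_apply x)
  have hcont : ∀ f : E →ₗ[ℝ] ℝ, (∀ x, |f x| ≤ q x) → Continuous f := fun f hf => by
    have h1 : Continuous ((normSeminorm ℝ ℝ).comp f) := Seminorm.continuous_of_le hq hf
    exact WithSeminorms.continuous_of_continuous_comp (norm_withSeminorms ℝ ℝ) f fun _ => h1
  let Φ : P → StrongDual ℝ E := fun f =>
    { toFun := f.1
      map_add' := f.2.1
      map_smul' := f.2.2.1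
      cont := hcont ⟨⟨f.1, f.2.1⟩, f.2.2.1⟩ fun x => abs_le.2 (f.2.2.2 x) }
  have hΦ : Continuous Φ := by
    rw [continuous_iff_continuousAt]
    intro f₀
    rw [ContinuousAt, ← tendsto_sub_nhds_zero_iff]
    intro W hW
    obtain ⟨B, hB, hBW⟩ := StrongDual.exists_polar_subset hW
    have hc := MontelSpace.isCompact_of_isClosed_of_isVonNBounded ℝ isClosed_closure hB.closure
    obtain ⟨t, -, ht⟩ := hc.elim_nhds_subcover (fun b => {x | q (x - b) < 1 / 4}) fun b _ => by
      have h1 : Continuous fun x => q (x - b) := by fun_prop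
      exact (h1.tendsto' b 0 (by simp)).eventually_lt_const (by norm_num)
    have hev : ∀ᶠ f : P in 𝓝 f₀, ∀ b ∈ t, |f.1 b - f₀.1 b| < 1 / 2 := by
      rw [Filter.eventually_all_finset]
      intro b _
      have h1 : Continuous fun f : P => |f.1 b - f₀.1 b| :=
        (((continuous_apply b).comp continuous_subtype_val).sub continuous_const).abs
      exact (h1.tendsto' f₀ 0 (by simp)).eventually_lt_const (by norm_num)
    rw [Filter.mem_map]
    filter_upwards [hev] with f hf
    refine hBW _ fun x hx => ?_
    obtain ⟨b, hb, hxb⟩ := mem_iUnion₂.1 (ht (subset_closure hx))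
    have hxb' : q (x - b) < 1 / 4 := hxb
    have e1 : f.1 x = f.1 b + f.1 (x - b) := by rw [← f.2.1, add_sub_cancel]
    have e2 : f₀.1 x = f₀.1 b + f₀.1 (x - b) := by rw [← f₀.2.1, add_sub_cancel]
    have h2 := abs_lt.1 (hf b hb)
    have h3 := f.2.2.2 (x - b)
    have h4 := f₀.2.2.2 (x - b)
    change |f.1 x - f₀.1 x| ≤ 1
    rw [e1, e2, abs_le]
    exact ⟨by linarith [h3.1, h4.2], by linarith [h3.2, h4.1]⟩
  have hrange : q.dualBall = range Φ := by
    ext χ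
    constructor
    · intro hχ
      exact ⟨⟨χ, fun x y => map_add χ x y, fun a x => map_smul χ a x, fun x => abs_le.1 (hχ x)⟩,
        rfl⟩
    · rintro ⟨f, rfl⟩ x
      exact abs_le.2 (f.2.2.2 x)
  have : CompactSpace P := isCompact_iff_compactSpace.1 hP
  rw [hrange]
  exact isCompact_range hΦ

/-- A subset of a metrizable Montel space that is separated for a continuous seminorm is
countable. Otherwise, passing to uncountable subsets on which more and more seminorms are
bounded, one finds a bounded separated sequence. -/
theorem MontelSpace.countable_of_separated {E : Type*} [AddCommGroup E] [Module ℝ E]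
    [TopologicalSpace E] [IsTopologicalAddGroup E] [ContinuousSMul ℝ E] [LocallyConvexSpace ℝ E]
    [T2Space E] [FirstCountableTopology E] [MontelSpace ℝ E] {p : Seminorm ℝ E}
    (hp : Continuous p) {A : Set E} (hA : A.Pairwise fun a b => 1 ≤ p (a - b)) :
    A.Countable := by
  by_contra hunc
  obtain ⟨q, hqm, hqc, hq⟩ := exists_monotone_seminorm_seq E
  have step : ∀ (i : ℕ) (S : {S : Set E // ¬ S.Countable}),
      ∃ m : ℕ, ¬ {a ∈ S.1 | q i a ≤ m}.Countable := fun i S => by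
    by_contra! h
    refine S.2 ((countable_iUnion h).mono fun a ha => ?_)
    obtain ⟨m, hm⟩ := exists_nat_ge (q i a)
    exact mem_iUnion.2 ⟨m, ha, hm⟩
  choose m hm using step
  let T : ℕ → {S : Set E // ¬ S.Countable} := fun i =>
    Nat.rec ⟨A, hunc⟩ (fun i S => ⟨{a ∈ S.1 | q i a ≤ m i S}, hm i S⟩) i
  have hTs : ∀ i, (T (i + 1)).1 = {a ∈ (T i).1 | q i a ≤ m i (T i)} := fun _ => rfl
  have hTanti : Antitone fun i => (T i).1 := antitone_nat_of_succ_le fun i a ha => by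
    rw [hTs] at ha
    exact ha.1
  obtain ⟨f, hf1, hf2⟩ := exists_seq_of_forall_finset_exists (α := ℕ × E)
    (fun x => x.2 ∈ (T x.1).1) (fun x y => x.1 < y.1 ∧ x.2 ≠ y.2) fun s _ => by
      classical
      obtain ⟨a, ha, ha'⟩ := (Set.Infinite.exists_notMem_finset
        (fun h => (T (s.sup Prod.fst + 1)).2 h.countable) (s.image Prod.snd))
      refine ⟨(s.sup Prod.fst + 1, a), ha, fun x hx => ⟨?_, ?_⟩⟩
      · exact Nat.lt_succ_of_le (Finset.le_sup (f := Prod.fst) hx)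
      · rintro rfl
        exact ha' (Finset.mem_image_of_mem _ hx)
  let a : ℕ → E := fun n => (f n).2
  have hidx : ∀ n, n ≤ (f n).1 := fun n =>
    (strictMono_nat_of_lt_succ fun n => (hf2 n (n + 1) n.lt_succ_self).1).le_apply
  have haA : ∀ n, a n ∈ A := fun n => hTanti (Nat.zero_le _) (hf1 n)
  have hane : ∀ i j, i < j → 1 ≤ p (a i - a j) := fun i j hij =>
    hA (haA i) (haA j) (hf2 i j hij).2
  have hbdd : IsVonNBounded ℝ (range a) := by
    rw [(PolynormableSpace.withSeminorms ℝ E).isVonNBounded_iff_seminorm_bddAbove]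
    rintro ⟨r, hr⟩
    obtain ⟨i, hi⟩ := hq r hr
    obtain ⟨M, hM⟩ := ((finite_Iic i).image fun n => r (a n)).bddAbove
    refine ⟨max M (m i (T i)), ?_⟩
    rintro - ⟨-, ⟨n, rfl⟩, rfl⟩
    rcases le_or_gt n i with hn | hn
    · exact le_max_of_le_left (hM (mem_image_of_mem _ hn))
    · have h1 : a n ∈ (T (i + 1)).1 := hTanti (Nat.succ_le_of_lt (hn.trans_le (hidx n))) (hf1 n)
      rw [hTs] at h1
      exact le_max_of_le_right ((hi _).trans h1.2)
  have hc := MontelSpace.isCompact_of_isClosed_of_isVonNBounded ℝ isClosed_closure hbdd.closure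
  obtain ⟨l, -, φ, hφ, hl⟩ := hc.tendsto_subseq fun n => subset_closure (mem_range_self n)
  have h1 : Tendsto (fun n => a (φ n) - a (φ (n + 1))) atTop (𝓝 (l - l)) :=
    hl.sub (hl.comp (tendsto_add_atTop_nat 1))
  rw [sub_self] at h1
  have h2 := ((hp.tendsto' 0 0 (map_zero p)).comp h1).eventually_lt_const one_pos
  obtain ⟨n, hn⟩ := h2.exists
  exact absurd hn (not_lt.2 (hane _ _ (hφ n.lt_succ_self)))

/-- Metrizable Montel spaces are separable. -/
theorem MontelSpace.exists_countable_dense {E : Type*} [AddCommGroup E] [Module ℝ E]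
    [TopologicalSpace E] [IsTopologicalAddGroup E] [ContinuousSMul ℝ E] [LocallyConvexSpace ℝ E]
    [T2Space E] [FirstCountableTopology E] [MontelSpace ℝ E] :
    ∃ D : Set E, D.Countable ∧ Dense D := by
  obtain ⟨q, hqm, hqc, hq⟩ := exists_monotone_seminorm_seq E
  -- A maximal `q n`-separated set is a `q n`-net.
  have hnet : ∀ n, ∃ D : Set E, D.Countable ∧ ∀ x, ∃ d ∈ D, q n (x - d) < 1 := fun n => by
    obtain ⟨D, hD⟩ := zorn_subset {A : Set E | A.Pairwise fun a b => 1 ≤ q n (a - b)}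
      fun c hc hchain => ⟨⋃₀ c, (pairwise_sUnion hchain.directedOn).2 fun s hs => hc hs,
        fun s hs => subset_sUnion_of_mem hs⟩
    refine ⟨D, MontelSpace.countable_of_separated (hqc n) hD.prop, fun x => ?_⟩
    by_contra! hcon
    have hxD : x ∈ D := hD.mem_of_prop_insert (show (insert x D).Pairwise _ from
      pairwise_insert.2
        ⟨hD.prop, fun b hb _ => ⟨hcon b hb, by simpa only [map_sub_rev] using hcon b hb⟩⟩)
    exact absurd (hcon x hxD) (by simp)
  choose D hDc hD using hnet
  refine ⟨⋃ n, D n, countable_iUnion hDc, fun x => ?_⟩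
  rw [mem_closure_iff_nhds]
  intro W hW
  have hW' : (fun y => x - y) ⁻¹' W ∈ 𝓝 (0 : E) :=
    (continuous_const.sub continuous_id).continuousAt.preimage_mem_nhds (by simpa using hW)
  obtain ⟨r, hr, hrW⟩ := exists_continuous_seminorm_of_mem_nhds hW'
  obtain ⟨n, hn⟩ := hq r hr
  obtain ⟨d, hd, hxd⟩ := hD n x
  exact ⟨d, by simpa using hrW _ ((hn _).trans_lt hxd), mem_iUnion.2 ⟨n, hd⟩⟩

theorem StrongDual.exists_mem_dualBall {E : Type*} [AddCommGroup E] [Module ℝ E]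
    [TopologicalSpace E] (χ : StrongDual ℝ E) :
    ∃ p : Seminorm ℝ E, Continuous p ∧ χ ∈ p.dualBall :=
  ⟨(normSeminorm ℝ ℝ).comp χ.toLinearMap, χ.continuous.norm, fun _ => le_rfl⟩

theorem Seminorm.add_mem_dualBall {E : Type*} [AddCommGroup E] [Module ℝ E]
    [TopologicalSpace E] {p q : Seminorm ℝ E} {χ ψ : StrongDual ℝ E} (hχ : χ ∈ p.dualBall)
    (hψ : ψ ∈ q.dualBall) : χ + ψ ∈ (p + q).dualBall :=
  fun x => (abs_add_le _ _).trans (add_le_add (hχ x) (hψ x))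

/-- Uniform boundedness: pointwise bounded families of functionals on a barrelled space are
equicontinuous. -/
theorem BarrelledSpace.exists_forall_mem_dualBall {E : Type*} [AddCommGroup E] [Module ℝ E]
    [TopologicalSpace E] [BarrelledSpace ℝ E] {ι : Type*} (χ : ι → StrongDual ℝ E)
    (hχ : ∀ x, BddAbove (range fun i => |χ i x|)) :
    ∃ p : Seminorm ℝ E, Continuous p ∧ ∀ i, χ i ∈ p.dualBall := by
  let p : ι → Seminorm ℝ E := fun i => (normSeminorm ℝ ℝ).comp (χ i).toLinearMap
  have hp : BddAbove (range p) := by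
    rw [Seminorm.bddAbove_range_iff]
    exact hχ
  refine ⟨⨆ i, p i, ?_, fun i => le_ciSup hp i⟩
  rw [Seminorm.coe_iSup_eq hp]
  exact Seminorm.continuous_iSup p (fun i => (χ i).continuous.norm) hp

/-- Polars of neighbourhoods in a separable space are metrizable for the strong topology, being
compact and separated by evaluation at countably many points. -/
theorem Seminorm.metrizableSpace_dualBall {E : Type*} [AddCommGroup E] [Module ℝ E]
    [TopologicalSpace E] [IsTopologicalAddGroup E] [ContinuousSMul ℝ E] [T2Space E]
    [MontelSpace ℝ E] {D : Set E} (hDc : D.Countable) (hD : Dense D) {q : Seminorm ℝ E}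
    (hq : Continuous q) : TopologicalSpace.MetrizableSpace q.dualBall := by
  have : CompactSpace q.dualBall := isCompact_iff_compactSpace.1 (Seminorm.isCompact_dualBall hq)
  have : Countable D := hDc
  have hc : Continuous fun (χ : q.dualBall) (d : D) => χ.1 d.1 := by fun_prop
  refine (hc.isClosedEmbedding fun χ ψ h => ?_).isEmbedding.metrizableSpace
  refine Subtype.ext (DFunLike.coe_injective ?_)
  exact Continuous.ext_on hD χ.1.continuous ψ.1.continuous fun d hd => congrFun h ⟨d, hd⟩

/-- Banach–Dieudonné: in the dual of a metrizable Montel space, a set containing the origin is a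
neighbourhood of the origin if its complement has a closed trace on each of the compact sets
`(q n).dualBall`. One builds inductively finite sets whose union is bounded, since all but finitely
many of its points lie in a given neighbourhood of the origin, and has its polar in the given
set. -/
theorem mem_nhds_zero_of_forall_isClosed_dualBall_diff {E : Type*} [AddCommGroup E] [Module ℝ E]
    [TopologicalSpace E] [IsTopologicalAddGroup E] [ContinuousSMul ℝ E] [LocallyConvexSpace ℝ E]
    [T2Space E] [MontelSpace ℝ E] {q : ℕ → Seminorm ℝ E} (hqm : Monotone q)
    (hqc : ∀ n, Continuous (q n)) (hq : ∀ p : Seminorm ℝ E, Continuous p → ∃ n, p ≤ q n)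
    {W : Set (StrongDual ℝ E)} (h0 : 0 ∈ W) (hW : ∀ n, IsClosed ((q n).dualBall \ W)) :
    W ∈ 𝓝 0 := by
  -- `V 0` is the whole space, and the polar of `V (n + 1)` is `(q n).dualBall`.
  let V : ℕ → Set E := fun n => {x | ∀ m < n, q m x ≤ 1}
  have hV : ∀ {n m}, n ≤ m → V m ⊆ V n := fun h x hx k hk => hx k (hk.trans_le h)
  let I : ℕ → Set E → Prop := fun n S => ∀ χ : StrongDual ℝ E,
    (∀ x ∈ S, |χ x| ≤ 1) → (∀ x ∈ V n, |χ x| ≤ 1) → χ ∈ W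
  have step : ∀ n (S : {S : Set E // S.Finite ∧ I n S}),
      ∃ S' : {S : Set E // S.Finite ∧ I (n + 1) S}, S.1 ⊆ S'.1 ∧ S'.1 ⊆ S.1 ∪ V n := by
    rintro n ⟨S, hS, hI⟩
    have hcl : ∀ x : E, IsClosed {χ : StrongDual ℝ E | |χ x| ≤ 1} := fun x =>
      isClosed_le (by fun_prop) continuous_const
    have hcpt : IsCompact (((q n).dualBall \ W) ∩ ⋂ x ∈ S, {χ : StrongDual ℝ E | |χ x| ≤ 1}) :=
      ((Seminorm.isCompact_dualBall (hqc n)).of_isClosed_subset (hW n) sdiff_subset).inter_right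
        (isClosed_biInter fun x _ => hcl x)
    have hfin : ∃ u : Finset (V n), ¬ ((((q n).dualBall \ W) ∩
        ⋂ x ∈ S, {χ : StrongDual ℝ E | |χ x| ≤ 1}) ∩
        ⋂ x ∈ u, {χ : StrongDual ℝ E | |χ x.1| ≤ 1}).Nonempty := by
      by_contra! hcon
      obtain ⟨χ, ⟨⟨-, hχW⟩, hχS⟩, hχV⟩ := hcpt.inter_iInter_nonempty
        (fun x : V n => {χ : StrongDual ℝ E | |χ x.1| ≤ 1}) (fun x => hcl x.1) hcon
      exact hχW (hI χ (fun x hx => mem_iInter₂.1 hχS x hx) fun x hx => mem_iInter.1 hχV ⟨x, hx⟩)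
    obtain ⟨u, hu⟩ := hfin
    refine ⟨⟨S ∪ (↑) '' (u : Set (V n)), hS.union (u.finite_toSet.image _), ?_⟩,
      subset_union_left, union_subset_union_right _ ?_⟩
    · intro χ hχ1 hχ2
      by_contra hχW
      refine hu ⟨χ, ⟨⟨?_, hχW⟩, mem_iInter₂.2 fun x hx => hχ1 x (Or.inl hx)⟩,
        mem_iInter₂.2 fun x hx => hχ1 x (Or.inr (mem_image_of_mem _ hx))⟩
      exact Seminorm.mem_dualBall_of_forall_le_one fun x hx =>
        hχ2 x fun m hm => (hqm (Nat.lt_succ_iff.1 hm) x).trans hx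
    · rintro - ⟨x, -, rfl⟩
      exact x.2
  choose next hnext1 hnext2 using step
  let T : ∀ n, {S : Set E // S.Finite ∧ I n S} := fun n =>
    Nat.rec ⟨∅, finite_empty, fun χ _ hχ => by
      have h1 : χ ∈ (0 : Seminorm ℝ E).dualBall :=
        Seminorm.mem_dualBall_of_forall_le_one fun x _ => hχ x fun m hm => absurd hm m.not_lt_zero
      have h2 : χ = 0 := ContinuousLinearMap.ext fun x => abs_nonpos_iff.1 (h1 x)
      rwa [h2]⟩ next n
  have hTm : Monotone fun n => (T n).1 := monotone_nat_of_le_succ fun n => hnext1 n (T n)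
  have hTV : ∀ n m, (T m).1 ⊆ (T n).1 ∪ V n := fun n m => by
    rcases le_total m n with h | h
    · exact (hTm h).trans subset_union_left
    · induction m, h using Nat.le_induction with
      | base => exact subset_union_left
      | succ m hm ih => exact (hnext2 m (T m)).trans (union_subset ih
          ((hV hm).trans subset_union_right))
  have hbdd : IsVonNBounded ℝ (⋃ n, (T n).1) := by
    rw [(PolynormableSpace.withSeminorms ℝ E).isVonNBounded_iff_seminorm_bddAbove]
    rintro ⟨r, hr⟩
    obtain ⟨n, hn⟩ := hq r hr
    obtain ⟨M, hM⟩ := ((T (n + 1)).2.1.image r).bddAbove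
    refine ⟨max M 1, ?_⟩
    rintro - ⟨x, hx, rfl⟩
    obtain ⟨m, hm⟩ := mem_iUnion.1 hx
    rcases hTV (n + 1) m hm with h | h
    · exact le_max_of_le_left (hM (mem_image_of_mem _ h))
    · exact le_max_of_le_right ((hn x).trans (h n n.lt_succ_self))
  filter_upwards [ContinuousLinearMap.eventually_nhds_zero_mapsTo (𝕜₂ := ℝ) (F := ℝ)
    (σ := RingHom.id ℝ) hbdd (Metric.closedBall_mem_nhds 0 one_pos)] with χ hχ
  obtain ⟨p, hp, hχp⟩ := StrongDual.exists_mem_dualBall χ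
  obtain ⟨n, hn⟩ := hq p hp
  refine (T (n + 1)).2.2 χ (fun x hx => by simpa using hχ (mem_iUnion.2 ⟨n + 1, hx⟩))
    fun x hx => ((hχp x).trans (hn x)).trans (hx n n.lt_succ_self)

/-- The strong dual of a metrizable Montel space is the inductive limit of the polars of a base of
neighbourhoods of the origin. -/
theorem isMKOmegaSpace_strongDual (E : Type*) [AddCommGroup E] [Module ℝ E]
    [TopologicalSpace E] [IsTopologicalAddGroup E] [ContinuousSMul ℝ E] [LocallyConvexSpace ℝ E]
    [T2Space E] [MontelSpace ℝ E] [FirstCountableTopology E] :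
    IsMKOmegaSpace (StrongDual ℝ E) := by
  obtain ⟨q, hqm, hqc, hq⟩ := exists_monotone_seminorm_seq E
  obtain ⟨D, hDc, hD⟩ := MontelSpace.exists_countable_dense (E := E)
  refine ⟨inferInstance, fun n => (q n).dualBall, fun m n h => Seminorm.dualBall_mono (hqm h),
    ?_, fun n => Seminorm.isCompact_dualBall (hqc n),
    fun n => Seminorm.metrizableSpace_dualBall hDc hD (hqc n), fun U =>
    ⟨fun hU n => hU.preimage continuous_subtype_val, fun hU => ?_⟩⟩
  · refine eq_univ_of_forall fun χ => ?_
    obtain ⟨p, hp, hχ⟩ := StrongDual.exists_mem_dualBall χ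
    obtain ⟨n, hn⟩ := hq p hp
    exact mem_iUnion.2 ⟨n, Seminorm.dualBall_mono hn hχ⟩
  have hcl : ∀ n, IsClosed ((q n).dualBall \ U) := fun n => by
    have h1 := (Seminorm.isCompact_dualBall (hqc n)).isClosed.isClosedEmbedding_subtypeVal
    have h2 := h1.isClosedMap _ (hU n).isClosed_compl
    rwa [← preimage_compl, Subtype.image_preimage_coe, ← sdiff_eq] at h2
  rw [isOpen_iff_mem_nhds]
  intro χ hχ
  have h0 : (fun ψ => χ + ψ) ⁻¹' U ∈ 𝓝 0 := by
    refine mem_nhds_zero_of_forall_isClosed_dualBall_diff hqm hqc hq (by simpa using hχ)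
      fun n => ?_
    obtain ⟨p, hp, hχp⟩ := StrongDual.exists_mem_dualBall χ
    obtain ⟨m, hm⟩ := hq (p + q n) (hp.add (hqc n))
    have h1 : (q n).dualBall \ (fun ψ => χ + ψ) ⁻¹' U =
        (q n).dualBall ∩ (fun ψ => χ + ψ) ⁻¹' ((q m).dualBall \ U) := by
      ext ψ
      constructor
      · exact fun h => ⟨h.1, Seminorm.dualBall_mono hm (Seminorm.add_mem_dualBall hχp h.1), h.2⟩
      · exact fun h => ⟨h.1, h.2.2⟩
    rw [h1]
    exact (Seminorm.isCompact_dualBall (hqc n)).isClosed.inter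
      ((hcl m).preimage (continuous_const.add continuous_id))
  have h2 : (fun ψ => ψ - χ) ⁻¹' ((fun ψ => χ + ψ) ⁻¹' U) ∈ 𝓝 χ :=
    (continuous_id.sub continuous_const).continuousAt.preimage_mem_nhds (by simpa using h0)
  filter_upwards [h2] with ψ hψ
  have h3 : χ + (ψ - χ) ∈ U := hψ
  rwa [add_sub_cancel] at h3

theorem IsMKOmegaSpace.sequentialSpace {X : Type*} [TopologicalSpace X] (hX : IsMKOmegaSpace X) :
    SequentialSpace X := by
  obtain ⟨C, -, -, -, hC, hU⟩ := hX.exists_seq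
  refine ⟨fun s hs => ?_⟩
  rw [← isOpen_compl_iff, hU]
  intro n
  have := hC n
  rw [preimage_compl, isOpen_compl_iff]
  exact (hs.preimage continuous_subtype_val.seqContinuous).isClosed

/-- In the infinite-dimensional case the compact sets `q.dualBall` have empty interior, as the
dual would be locally compact otherwise. -/
theorem Seminorm.dualBall_notMem_nhds {E : Type*} [AddCommGroup E] [Module ℝ E]
    [TopologicalSpace E] [IsTopologicalAddGroup E] [ContinuousSMul ℝ E] [LocallyConvexSpace ℝ E]
    [T2Space E] [MontelSpace ℝ E] (hE : ¬ FiniteDimensional ℝ E) {q : Seminorm ℝ E}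
    (hq : Continuous q) : q.dualBall ∉ 𝓝 0 := by
  intro h
  have : LocallyCompactSpace (StrongDual ℝ E) :=
    (Seminorm.isCompact_dualBall hq).locallyCompactSpace_of_mem_nhds_of_addGroup h
  have : FiniteDimensional ℝ (StrongDual ℝ E) := FiniteDimensional.of_locallyCompactSpace ℝ
  let J : E →ₗ[ℝ] Module.Dual ℝ (StrongDual ℝ E) :=
    LinearMap.flip (ContinuousLinearMap.coeLM ℝ)
  refine hE (FiniteDimensional.of_injective J ?_)
  rw [← LinearMap.ker_eq_bot, LinearMap.ker_eq_bot']
  intro x hx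
  by_contra hne
  obtain ⟨χ, hχ⟩ := SeparatingDual.exists_ne_zero (R := ℝ) hne
  exact hχ (LinearMap.congr_fun hx χ)

/-- Choose `χ₀ e = 1` and consider the functionals `χ` with `χ e > 1 / (2 (n + 1))` that, for the
same `n`, differ from `χ₀ / (n + 1)` by a functional outside of the `n`-th compact set. The origin
is in the closure of the set of these `χ`, but it is not the limit of a sequence: convergent
sequences are equicontinuous, and `n` would have to tend to infinity along the sequence. -/
theorem not_frechetUrysohnSpace_strongDual {E : Type*} [AddCommGroup E] [Module ℝ E]
    [TopologicalSpace E] [IsTopologicalAddGroup E] [ContinuousSMul ℝ E] [LocallyConvexSpace ℝ E]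
    [T2Space E] [MontelSpace ℝ E] [BarrelledSpace ℝ E] [FirstCountableTopology E]
    (hE : ¬ FiniteDimensional ℝ E) : ¬ FrechetUrysohnSpace (StrongDual ℝ E) := by
  intro hFU
  obtain ⟨q, hqm, hqc, hq⟩ := exists_monotone_seminorm_seq E
  have : Nontrivial E := not_subsingleton_iff_nontrivial.1 fun h => hE inferInstance
  obtain ⟨e, he⟩ := exists_ne (0 : E)
  obtain ⟨χ₀, hχ₀⟩ := SeparatingDual.exists_eq_one (R := ℝ) he
  let t : ℕ → ℝ := fun n => 1 / ((n : ℝ) + 1)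
  have ht0 : ∀ n, 0 < t n := fun n => Nat.one_div_pos_of_nat
  have ht1 : ∀ n, t n ≤ 1 := fun n => by
    rw [div_le_one (by positivity)]
    linarith [n.cast_nonneg (α := ℝ)]
  have htlim : Tendsto t atTop (𝓝 0) := tendsto_one_div_add_atTop_nhds_zero_nat
  let A : Set (StrongDual ℝ E) := {χ | ∃ n, t n / 2 < χ e ∧ χ - t n • χ₀ ∉ (q n).dualBall}
  have hA : (0 : StrongDual ℝ E) ∈ closure A := by
    rw [mem_closure_iff]
    intro U hU h0
    have h1 : Tendsto (fun n => t n • χ₀) atTop (𝓝 0) := by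
      simpa using htlim.smul_const χ₀
    obtain ⟨n, hn⟩ := (h1.eventually_mem (hU.mem_nhds h0)).exists
    have h2 : ∀ᶠ ψ : StrongDual ℝ E in 𝓝 0, ψ + t n • χ₀ ∈ U :=
      (continuous_id.add continuous_const).continuousAt.preimage_mem_nhds
        (hU.mem_nhds (by simpa using hn))
    have h3 : ∀ᶠ ψ : StrongDual ℝ E in 𝓝 0, |ψ e| < t n / 2 := by
      have h4 : Continuous fun ψ : StrongDual ℝ E => |ψ e| := by fun_prop
      exact (h4.tendsto' 0 0 (by simp)).eventually_lt_const (half_pos (ht0 n))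
    obtain ⟨ψ, ⟨hψU, hψe⟩, hψ⟩ : ∃ ψ : StrongDual ℝ E,
        (ψ + t n • χ₀ ∈ U ∧ |ψ e| < t n / 2) ∧ ψ ∉ (q n).dualBall := by
      by_contra! hcon
      exact Seminorm.dualBall_notMem_nhds hE (hqc n)
        ((h2.and h3).mono fun ψ hψ => hcon ψ hψ)
    refine ⟨_, hψU, n, ?_, by simpa using hψ⟩
    simp only [add_apply, smul_apply, hχ₀, smul_eq_mul, mul_one]
    linarith [(abs_lt.1 hψe).1]
  obtain ⟨a, haA, ha⟩ := mem_closure_iff_seq_limit.1 hA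
  choose n hn1 hn2 using haA
  have hlim : ∀ x, Tendsto (fun j => a j x) atTop (𝓝 0) := fun x => by
    have h1 : Continuous fun ψ : StrongDual ℝ E => ψ x := by fun_prop
    exact (h1.tendsto' 0 0 rfl).comp ha
  obtain ⟨p, hp, hap⟩ := BarrelledSpace.exists_forall_mem_dualBall a
    fun x => (hlim x).abs.bddAbove_range
  obtain ⟨r, hr, hχr⟩ := StrongDual.exists_mem_dualBall (-χ₀)
  obtain ⟨m, hm⟩ := hq (p + r) (hp.add hr)
  obtain ⟨j, hj⟩ := ((hlim e).eventually_lt_const (half_pos (ht0 m))).exists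
  have hmj : m ≤ n j := by
    by_contra! hlt
    have h1 : t m ≤ t (n j) := one_div_le_one_div_of_le (by positivity)
      (by have : (n j : ℝ) ≤ m := by exact_mod_cast hlt.le
          linarith)
    linarith [hn1 j]
  refine hn2 j (Seminorm.dualBall_mono (hm.trans (hqm hmj)) ?_)
  have h1 : a j - t (n j) • χ₀ = a j + t (n j) • (-χ₀) := by
    ext x
    simp [sub_eq_add_neg]
  rw [h1]
  refine Seminorm.add_mem_dualBall (hap j) fun x => ?_
  rw [smul_apply, smul_eq_mul, abs_mul, abs_of_pos (ht0 _)]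
  exact (mul_le_of_le_one_left (abs_nonneg _) (ht1 _)).trans (hχr x)

/-! ### Spaces of test functions -/

/-- A seminorm on a space of test functions is continuous if on the functions supported in any given
compact set it is dominated by a multiple of one of the standard seminorms. -/
theorem TestFunction.continuous_seminorm {E F : Type*} [NormedAddCommGroup E] [NormedSpace ℝ E]
    [NormedAddCommGroup F] [NormedSpace ℝ F] {Ω : TopologicalSpace.Opens E} {n : ℕ∞}
    (p : Seminorm ℝ (TestFunction Ω F n))
    (hp : ∀ (K : TopologicalSpace.Compacts E) (hK : (K : Set E) ⊆ Ω), ∃ (C : NNReal) (i : ℕ),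
      ∀ f : ContDiffMapSupportedIn E F n K, p (TestFunction.ofSupportedIn hK f) ≤
        C * ContDiffMapSupportedIn.seminorm ℝ E F n K i f) : Continuous p := by
  have hle : TestFunction.topologicalSpace Ω F n ≤ p.inducedTopology := by
    let := p.inducedTopology
    have hw := p.withSeminorms_inducedTopology
    have := hw.topologicalAddGroup
    have := hw.continuousSMul
    have := hw.toLocallyConvexSpace
    rw [TestFunction.topologicalSpace_le_iff]
    refine iSup₂_le fun K hK => continuous_iff_coinduced_le.1 ?_
    obtain ⟨C, i, hC⟩ := hp K hK
    let L : ContDiffMapSupportedIn E F n K →ₗ[ℝ] TestFunction Ω F n :=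
      { toFun := TestFunction.ofSupportedIn hK
        map_add' := fun _ _ => rfl
        map_smul' := fun _ _ => rfl }
    refine p.continuous_to_inducedTopology L ?_
    have h1 : Continuous (C • ContDiffMapSupportedIn.seminorm ℝ E F n K i) :=
      ((ContDiffMapSupportedIn.withSeminorms ℝ E F n K).continuous_seminorm i).const_smul C
    exact Seminorm.continuous_of_le (p := p.comp L) h1 hC
  exact continuous_le_dom hle p.continuous_inducedTopology

theorem norm_iteratedFDeriv_comp_smul_add {E F : Type*} [NormedAddCommGroup E] [NormedSpace ℝ E]
    [NormedAddCommGroup F] [NormedSpace ℝ F] {g : E → F} (i : ℕ) (hg : ContDiff ℝ i g) (c : ℝ)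
    (y x : E) : ‖iteratedFDeriv ℝ i (fun x => g (c • x + y)) x‖ =
      |c| ^ i * ‖iteratedFDeriv ℝ i g (c • x + y)‖ := by
  have h1 : ContDiff ℝ i fun x => g (x + y) := hg.comp (contDiff_id.add contDiff_const)
  have h2 := (c • ContinuousLinearMap.id ℝ E).iteratedFDeriv_comp_right h1 x le_rfl
  have h3 : (fun x => g (c • x + y)) =
      (fun x => g (x + y)) ∘ (c • ContinuousLinearMap.id ℝ E) := rfl
  rw [h3, h2, iteratedFDeriv_comp_add_right]
  have h4 : ∀ M : ContinuousMultilinearMap ℝ (fun _ : Fin i => E) F,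
      M.compContinuousLinearMap (fun _ => c • ContinuousLinearMap.id ℝ E) = c ^ i • M := fun M => by
    ext v
    simpa using M.map_smul_univ (fun _ => c) v
  rw [h4, norm_smul, norm_pow, Real.norm_eq_abs]
  rfl

/-- A smooth function with compact support and an identically vanishing derivative of some order
vanishes: all derivatives of lower order are constant. -/
theorem exists_iteratedFDeriv_ne_zero {E F : Type*} [NormedAddCommGroup E] [NormedSpace ℝ E]
    [NormedAddCommGroup F] [NormedSpace ℝ F] [NoncompactSpace E] {g : E → F}
    (hg : ContDiff ℝ (⊤ : ℕ∞) g) (hgc : HasCompactSupport g) (hg0 : g ≠ 0) (i : ℕ) :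
    ∃ y, iteratedFDeriv ℝ i g y ≠ 0 := by
  by_contra! h
  induction i with
  | zero => exact hg0 (funext fun y => norm_eq_zero.1 (by simpa using congrArg norm (h y)))
  | succ i ih =>
    refine ih fun y => ?_
    have hd : Differentiable ℝ (iteratedFDeriv ℝ i g) :=
      hg.differentiable_iteratedFDeriv (WithTop.coe_lt_coe.2 (ENat.natCast_lt_top i))
    have hc := is_const_of_fderiv_eq_zero hd fun x => norm_eq_zero.1 (by
      rw [norm_fderiv_iteratedFDeriv, h x, norm_zero])
    obtain ⟨x, hx⟩ : ∃ x, x ∉ tsupport (iteratedFDeriv ℝ i g) :=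
      (ne_univ_iff_exists_notMem _).1 (hgc.iteratedFDeriv i).ne_univ
    rw [hc y x, image_eq_zero_of_notMem_tsupport hx]

theorem IsOpen.not_isCompact {E : Type*} [NormedAddCommGroup E] [NormedSpace ℝ E] [Nontrivial E]
    {Ω : Set E} (hΩ : IsOpen Ω) (hne : Ω.Nonempty) : ¬ IsCompact Ω := fun h => by
  have : NoncompactSpace E := NormedSpace.noncompactSpace ℝ E
  exact h.ne_univ (IsClopen.eq_univ ⟨h.isClosed, hΩ⟩ hne)

theorem exists_seq_finite_setOf_mem_compact {E : Type*} [NormedAddCommGroup E] [NormedSpace ℝ E]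
    [FiniteDimensional ℝ E] [Nontrivial E] {Ω : Set E} (hΩ : IsOpen Ω) (hne : Ω.Nonempty)
    {K₀ : Set E} (hK₀ : IsCompact K₀) (hK₀Ω : K₀ ⊆ Ω) : ∃ z : ℕ → E, (∀ n, z n ∈ Ω) ∧
      (∀ n, z n ∉ K₀) ∧ ∀ K ⊆ Ω, IsCompact K → {n | z n ∈ K}.Finite := by
  have : ProperSpace E := FiniteDimensional.proper ℝ E
  have : LocallyCompactSpace Ω := hΩ.locallyCompactSpace
  have : NoncompactSpace Ω := not_compactSpace_iff.1 fun h =>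
    hΩ.not_isCompact hne (isCompact_iff_compactSpace.2 h)
  have hcpt : ∀ K ⊆ Ω, IsCompact K → IsCompact ((↑) ⁻¹' K : Set Ω) := fun K hK hKc =>
    (Topology.IsInducing.subtypeVal.isCompact_preimage_iff (by simpa using hK)).2 hKc
  let C : CompactExhaustion Ω := default
  have h : ∀ n, ∃ z : Ω, z ∉ C n ∪ (↑) ⁻¹' K₀ := fun n =>
    (ne_univ_iff_exists_notMem _).1 ((C.isCompact n).union (hcpt _ hK₀Ω hK₀)).ne_univ
  choose z hz using h
  refine ⟨fun n => z n, fun n => (z n).2, fun n h => hz n (Or.inr h), fun K hK hKc => ?_⟩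
  obtain ⟨m, hm⟩ := C.exists_superset_of_isCompact (hcpt K hK hKc)
  refine (finite_lt_nat m).subset fun n hn => ?_
  by_contra hmn
  exact hz n (Or.inl (C.subset (not_lt.1 hmn) (hm hn)))

/-- The strong dual of the space of test functions on a nonempty open set is not Ascoli. The
functionals in the criterion are evaluations at points `z n` escaping from every compact subset.
The vectors `w n k` are translates of `c ^ (-n) g (c x)` for large `c`, where `g` is a fixed bump
function: their derivatives of order at most `n` stay bounded while those of order `n + 1` become
large. -/
theorem not_isAscoliSpace_strongDual_testFunction {E : Type*} [NormedAddCommGroup E]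
    [NormedSpace ℝ E] [FiniteDimensional ℝ E] [Nontrivial E] (Ω : TopologicalSpace.Opens E)
    (hΩ : (Ω : Set E).Nonempty) : ¬ IsAscoliSpace (StrongDual ℝ (TestFunction Ω ℝ ⊤)) := by
  have : ProperSpace E := FiniteDimensional.proper ℝ E
  have : NoncompactSpace E := NormedSpace.noncompactSpace ℝ E
  obtain ⟨z₀, hz₀⟩ := hΩ
  obtain ⟨r, hr, hrΩ⟩ := Metric.nhds_basis_closedBall.mem_iff.1 (Ω.isOpen.mem_nhds hz₀)
  let K₀ : TopologicalSpace.Compacts E := ⟨Metric.closedBall z₀ r, isCompact_closedBall z₀ r⟩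
  obtain ⟨z, hzΩ, hzK₀, hz⟩ :=
    exists_seq_finite_setOf_mem_compact Ω.isOpen ⟨z₀, hz₀⟩ K₀.isCompact hrΩ
  obtain ⟨g, hgsupp, hgc, hg, -, hg0⟩ := exists_contDiff_tsupport_subset (n := ⊤)
    (Metric.ball_mem_nhds (0 : E) one_pos)
  have hgi : ∀ i : ℕ, ContDiff ℝ i g := fun i => hg.of_le (WithTop.coe_le_coe.2 le_top)
  choose y hy using exists_iteratedFDeriv_ne_zero hg hgc
    (fun h => by simp [h] at hg0)
  have hsupp1 : ∀ x, g x ≠ 0 → ‖x‖ < 1 := fun x hx => by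
    simpa using hgsupp (subset_tsupport g hx)
  have hy1 : ∀ i, ‖y i‖ < 1 := fun i => by
    simpa using hgsupp (support_iteratedFDeriv_subset i (hy i))
  have hgM : ∀ i : ℕ, ∃ M : ℝ, ∀ x, ‖iteratedFDeriv ℝ i g x‖ ≤ M := fun i =>
    ((hgi i).continuous_iteratedFDeriv le_rfl).bounded_above_of_compact_support
      (hgc.iteratedFDeriv i)
  choose M hM using hgM
  have hM0 : ∀ i, 0 ≤ M i := fun i => (norm_nonneg _).trans (hM i 0)
  -- Scales `c n k`, large enough for the support condition and for the derivative condition.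
  have hc : ∀ n k : ℕ, ∃ c : ℝ, 1 ≤ c ∧ 2 ≤ c * r ∧
      k ≤ c * ‖iteratedFDeriv ℝ (n + 1) g (y (n + 1))‖ := fun n k => by
    have h1 := norm_pos_iff.2 (hy (n + 1))
    refine ⟨max 1 (max (2 / r) (k / ‖iteratedFDeriv ℝ (n + 1) g (y (n + 1))‖)), le_max_left _ _,
      ?_, ?_⟩
    · rw [← div_le_iff₀ hr]
      exact (le_max_left _ _).trans (le_max_right _ _)
    · rw [← div_le_iff₀ h1]
      exact (le_max_right _ _).trans (le_max_right _ _)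
  choose c hc1 hcr hck using hc
  have hc0 : ∀ n k, 0 < c n k := fun n k => one_pos.trans_le (hc1 n k)
  let a : ℕ → ℕ → E := fun n k => y (n + 1) - c n k • z₀
  have haz : ∀ n k x, c n k • x + a n k = c n k • (x - z₀) + y (n + 1) := fun n k x => by
    simp only [a, smul_sub]
    abel
  have hgca : ∀ n k, ContDiff ℝ (⊤ : ℕ∞) fun x => g (c n k • x + a n k) := fun n k =>
    hg.comp ((contDiff_const_smul _).add contDiff_const)
  let u : ℕ → ℕ → ContDiffMapSupportedIn E ℝ ⊤ K₀ := fun n k =>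
    ContDiffMapSupportedIn.of_support_subset
      (f := fun x => ((c n k) ^ n)⁻¹ • g (c n k • x + a n k)) ((hgca n k).const_smul _) (by
        intro x hx
        have h1 : ‖c n k • (x - z₀) + y (n + 1)‖ < 1 := by
          rw [← haz]
          exact hsupp1 _ (right_ne_zero_of_smul hx)
        have h2 : ‖c n k • (x - z₀)‖ ≤ c n k * r := by
          have h3 := norm_sub_le (c n k • (x - z₀) + y (n + 1)) (y (n + 1))
          rw [add_sub_cancel_right] at h3
          linarith [hy1 (n + 1), hcr n k]
        rw [norm_smul, Real.norm_eq_abs, abs_of_pos (hc0 n k)] at h2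
        exact mem_closedBall_iff_norm.2 (le_of_mul_le_mul_left h2 (hc0 n k)))
  have hu : ∀ n k i x, ‖iteratedFDeriv ℝ i (u n k) x‖ =
      ((c n k) ^ n)⁻¹ * ((c n k) ^ i * ‖iteratedFDeriv ℝ i g (c n k • x + a n k)‖) := by
    intro n k i x
    have h1 : iteratedFDeriv ℝ i (u n k) x =
        ((c n k) ^ n)⁻¹ • iteratedFDeriv ℝ i (fun x => g (c n k • x + a n k)) x :=
      iteratedFDeriv_const_smul_apply
        ((hgca n k).of_le (WithTop.coe_le_coe.2 le_top)).contDiffAt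
    rw [h1, norm_smul, norm_iteratedFDeriv_comp_smul_add i (hgi i), abs_of_pos (hc0 n k),
      Real.norm_of_nonneg (by have := hc0 n k; positivity)]
  -- A bump function that does not vanish at `z n`.
  have hx : ∀ n, ∃ f : TestFunction Ω ℝ ⊤, f (z n) = 1 := fun n => by
    obtain ⟨f, hf1, hf2, hf3, -, hf4⟩ := exists_contDiff_tsupport_subset (n := ⊤)
      (Ω.isOpen.mem_nhds (hzΩ n))
    exact ⟨⟨f, hf3, hf2, hf1⟩, hf4⟩
  choose x hx using hx
  let ζ : ℕ → StrongDual ℝ (TestFunction Ω ℝ ⊤) := fun n =>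
    { toFun := fun f => f (z n)
      map_add' := fun _ _ => rfl
      map_smul' := fun _ _ => rfl
      cont := by fun_prop }
  -- The derivative of order `n + 1` at `z₀`.
  let D : ∀ n : ℕ, TestFunction Ω ℝ ⊤ →ₗ[ℝ]
      ContinuousMultilinearMap ℝ (fun _ : Fin (n + 1) => E) ℝ := fun n =>
    { toFun := fun f => iteratedFDeriv ℝ (n + 1) f z₀
      map_add' := fun f₁ f₂ => iteratedFDeriv_add_apply
        (f₁.contDiff.of_le (WithTop.coe_le_coe.2 le_top)).contDiffAt
        (f₂.contDiff.of_le (WithTop.coe_le_coe.2 le_top)).contDiffAt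
      map_smul' := fun s f =>
        iteratedFDeriv_const_smul_apply
          (f.contDiff.of_le (WithTop.coe_le_coe.2 le_top)).contDiffAt }
  refine not_isAscoliSpace_strongDual_of_functionals x
    (fun n k => TestFunction.ofSupportedInCLM ℝ hrΩ (u n k)) ζ
    (fun n => (normSeminorm ℝ _).comp (D n)) (fun κ => ?_) (fun n => ?_) (fun n k => ?_)
    (fun n => ?_) (fun n k => ?_) (fun b => ?_)
  · have h1 : IsVonNBounded ℝ (range fun n => u n (κ n)) := by
      rw [(ContDiffMapSupportedIn.withSeminorms ℝ E ℝ ⊤ K₀).isVonNBounded_iff_seminorm_bddAbove]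
      intro i
      obtain ⟨B, hB⟩ := ((finite_lt_nat i).image fun n =>
        ContDiffMapSupportedIn.seminorm ℝ E ℝ ⊤ K₀ i (u n (κ n))).bddAbove
      refine ⟨max B (M i), ?_⟩
      rintro - ⟨-, ⟨n, rfl⟩, rfl⟩
      rcases lt_or_ge n i with hn | hn
      · exact le_max_of_le_left (hB (mem_image_of_mem _ hn))
      · refine le_max_of_le_right
          ((ContDiffMapSupportedIn.seminorm_top_le_iff ℝ (hM0 i) i _).2 fun x _ => ?_)
        rw [hu, inv_mul_le_iff₀ (pow_pos (hc0 _ _) _)]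
        exact mul_le_mul (pow_le_pow_right₀ (hc1 _ _) hn) (hM i _) (norm_nonneg _)
          (pow_pos (hc0 _ _) _).le
    have h2 := h1.image (TestFunction.ofSupportedInCLM ℝ hrΩ)
    rwa [← range_comp] at h2
  · refine TestFunction.continuous_seminorm _ fun K hK => ⟨1, n + 1, fun f => ?_⟩
    rw [NNReal.coe_one, one_mul]
    exact ContDiffMapSupportedIn.norm_iteratedFDeriv_apply_le_seminorm_top ℝ
  · -- The function `w n k` is centred so that its derivative at `z₀` is that of `g` at `y (n + 1)`,
    -- up to the scale.
    refine (hck n k).trans_eq ?_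
    have h1 : ((normSeminorm ℝ _).comp (D n)) (TestFunction.ofSupportedInCLM ℝ hrΩ (u n k)) =
      ‖iteratedFDeriv ℝ (n + 1) (u n k) z₀‖ := rfl
    have h2 := (hc0 n k).ne'
    rw [h1, hu, haz, sub_self, smul_zero, zero_add]
    field_simp
    ring
  · change x n (z n) ≠ 0
    rw [hx]
    exact one_ne_zero
  · exact (u n k).zero_on_compl (hzK₀ n)
  · let p : ℕ → Seminorm ℝ (TestFunction Ω ℝ ⊤) := fun n =>
      ‖b n‖₊ • (normSeminorm ℝ ℝ).comp (ζ n).toLinearMap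
    have hpa : ∀ n f, p n f = |b n| * |f (z n)| := fun _ _ => rfl
    -- On functions supported in a compact set, only finitely many of the seminorms do not vanish.
    have hK : ∀ K ⊆ (Ω : Set E), IsCompact K → ∃ B : NNReal, ∀ n (f : TestFunction Ω ℝ ⊤) (N : ℝ),
        0 ≤ N → (∀ x ∉ K, f x = 0) → (∀ x, |f x| ≤ N) → p n f ≤ B * N := by
      intro K hKΩ hKc
      have hfin := hz K hKΩ hKc
      refine ⟨∑ n ∈ hfin.toFinset, ‖b n‖₊, fun n f N hN hf0 hfN => ?_⟩
      rw [hpa]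
      by_cases hn : z n ∈ K
      · have h1 : ‖b n‖₊ ≤ ∑ n ∈ hfin.toFinset, ‖b n‖₊ :=
          Finset.single_le_sum (f := fun n => ‖b n‖₊) (fun _ _ => zero_le) (by simpa using hn)
        exact mul_le_mul (by exact_mod_cast h1) (hfN _) (abs_nonneg _) (NNReal.coe_nonneg _)
      · rw [hf0 _ hn, abs_zero, mul_zero]
        positivity
    have hbdd : BddAbove (range p) := by
      rw [Seminorm.bddAbove_range_iff]
      intro f
      obtain ⟨B, hB⟩ := hK _ f.tsupport_subset f.hasCompactSupport
      obtain ⟨N, hN⟩ := f.continuous.bounded_above_of_compact_support f.hasCompactSupport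
      refine ⟨B * N, ?_⟩
      rintro - ⟨n, rfl⟩
      exact hB n f N ((norm_nonneg _).trans (hN 0))
        (fun x hx => image_eq_zero_of_notMem_tsupport hx) hN
    refine ⟨⨆ n, p n, TestFunction.continuous_seminorm _ fun K hKΩ => ?_, fun n f => ?_⟩
    · obtain ⟨B, hB⟩ := hK K hKΩ K.isCompact
      refine ⟨B, 0, fun f => ?_⟩
      rw [Seminorm.iSup_apply hbdd]
      exact ciSup_le fun n => hB n _ _ (apply_nonneg _ _) (fun x hx => f.zero_on_compl hx)
        fun x => ContDiffMapSupportedIn.norm_apply_le_seminorm ℝ (f := f) (x := x)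
    · refine le_trans ?_ (le_ciSup hbdd n f)
      rw [hpa]
      exact mul_le_mul_of_nonneg_right (le_abs_self _) (abs_nonneg _)

/-! ### The Ascoli property of the strong dual -/

theorem isAscoliSpace_strongDual_of_isFrechetSpace {E : Type*} [AddCommGroup E] [Module ℝ E]
    [TopologicalSpace E] [IsTopologicalAddGroup E] [ContinuousSMul ℝ E] [LocallyConvexSpace ℝ E]
    [T2Space E] [MontelSpace ℝ E] (hE : IsFrechetSpace E) : IsAscoliSpace (StrongDual ℝ E) := by
  have := hE.metrizableSpace
  have := (isMKOmegaSpace_strongDual E).sequentialSpace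
  have : T35Space (StrongDual ℝ E) := {}
  exact IsAscoliSpace.of_sequentialSpace

theorem nonempty_strongDual_equiv_of_equiv_phi {E : Type*} [AddCommGroup E] [Module ℝ E]
    [TopologicalSpace E] (e : E ≃L[ℝ] Phi) : Nonempty (StrongDual ℝ E ≃L[ℝ] (ℕ → ℝ)) :=
  ⟨(e.arrowCongr (ContinuousLinearEquiv.refl ℝ ℝ)).trans Phi.strongDualEquiv⟩

theorem isAscoliSpace_strongDual_of_equiv_phi {E : Type*} [AddCommGroup E] [Module ℝ E]
    [TopologicalSpace E] [IsTopologicalAddGroup E] [ContinuousSMul ℝ E]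
    (e : E ≃L[ℝ] Phi) : IsAscoliSpace (StrongDual ℝ E) := by
  obtain ⟨f⟩ := nonempty_strongDual_equiv_of_equiv_phi e
  have := f.toHomeomorph.isEmbedding.firstCountableTopology
  have : T35Space (StrongDual ℝ E) := {}
  exact IsAscoliSpace.of_sequentialSpace

/-- If the steps of a strict (LF)-space are proper subspaces and one of them is
infinite-dimensional, the steps from there on violate the Ascoli property of the strong dual. -/
theorem isFrechetSpace_or_nonempty_equiv_phi {E : Type*} [AddCommGroup E] [Module ℝ E]
    [TopologicalSpace E] [IsTopologicalAddGroup E] [ContinuousSMul ℝ E] [LocallyConvexSpace ℝ E]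
    [T2Space E] [MontelSpace ℝ E] [BarrelledSpace ℝ E] (hE : IsStrictLFSpace E)
    (hA : IsAscoliSpace (StrongDual ℝ E)) : IsFrechetSpace E ∨ Nonempty (E ≃L[ℝ] Phi) := by
  obtain ⟨F, hF, hcov, hfr, hcl, hsem⟩ := hE.exists_submodules
  by_cases htop : ∃ n, F n = ⊤
  · obtain ⟨n, hn⟩ := htop
    exact Or.inl (IsFrechetSpace.of_eq_top (F n) (hfr n) hn)
  have hne : ∀ n, F n ≠ ⊤ := fun n h => htop ⟨n, h⟩
  by_cases hdim : ∀ n, FiniteDimensional ℝ (F n)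
  · exact Or.inr (nonempty_continuousLinearEquiv_phi F hF hcov hne hdim hsem)
  obtain ⟨N, hN⟩ := not_forall.1 hdim
  have := (hfr N).metrizableSpace
  refine absurd hA (not_isAscoliSpace_of_submodules (fun n => F (N + n))
    (fun m n h => hF (Nat.add_le_add_left h N)) (fun x => ?_) (fun n => hcl _) (fun n => hne _) hN)
  obtain ⟨n, hn⟩ := hcov x
  exact ⟨n, hF (Nat.le_add_left n N) hn⟩

theorem theoremt :
    (∀ (E : Type*) [AddCommGroup E] [Module ℝ E] [TopologicalSpace E] [IsTopologicalAddGroup E]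
      [ContinuousSMul ℝ E] [LocallyConvexSpace ℝ E] [T2Space E]
      [MontelSpace ℝ E] [BarrelledSpace ℝ E], IsStrictLFSpace E →
      (IsAscoliSpace (StrongDual ℝ E) ↔ IsFrechetSpace E ∨ Nonempty (E ≃L[ℝ] Phi)) ∧
      (IsFrechetSpace E →
        SequentialSpace (StrongDual ℝ E) ∧ IsMKOmegaSpace (StrongDual ℝ E) ∧
          (¬ FiniteDimensional ℝ E → ¬ FrechetUrysohnSpace (StrongDual ℝ E))) ∧
      (Nonempty (E ≃L[ℝ] Phi) → Nonempty (StrongDual ℝ E ≃L[ℝ] (ℕ → ℝ)))) ∧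
    (∀ (d : ℕ) (Ω : TopologicalSpace.Opens (EuclideanSpace ℝ (Fin d))), 1 ≤ d →
      (Ω : Set (EuclideanSpace ℝ (Fin d))).Nonempty →
      ¬ IsAscoliSpace (StrongDual ℝ (TestFunction Ω ℝ ⊤))) := by
  refine ⟨?_, fun d Ω hd hΩ => ?_⟩
  · intro E _ _ _ _ _ _ _ _ _ hE
    refine ⟨⟨isFrechetSpace_or_nonempty_equiv_phi hE, ?_⟩, fun hFr => ?_, ?_⟩
    · rintro (hFr | ⟨⟨e⟩⟩)
      · exact isAscoliSpace_strongDual_of_isFrechetSpace hFr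
      · exact isAscoliSpace_strongDual_of_equiv_phi e
    · have := hFr.metrizableSpace
      exact ⟨(isMKOmegaSpace_strongDual E).sequentialSpace, isMKOmegaSpace_strongDual E,
        not_frechetUrysohnSpace_strongDual⟩
    · rintro ⟨e⟩
      exact nonempty_strongDual_equiv_of_equiv_phi e
  · have : Nonempty (Fin d) := ⟨⟨0, hd⟩⟩
    exact not_isAscoliSpace_strongDual_testFunction Ω hΩ
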